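/- For $x\in\mathbb R$ let $\{x\}$ be its fractional part, let $B_1(x)=\{x\}-\tfrac12$ if $x\notin\mathbb Z$ and $B_1(x)=0$ if $x\in\mathbb Z$. For $x\in[0,1)$ put $\alpha_0(x)=x$, $\alpha_k(x)=\{1/\alpha_{k-1}(x)\}$ as long as $\alpha_{k-1}(x)\neq 0$, and $\beta_{k}(x)=\alpha_0(x)\cdots\alpha_{k}(x)$, $\beta_{-1}(x)=1$. For a function $g:(0,1)\to\mathbb R$ and $x\in[0,1)$ let $$\mathcal S_g(x)=\sum_{k\ge 0}(-1)^k\beta_{k-1}(x)\,g(\alpha_k(x)),$$ where, if $x$ is rational, the sum is limited to the indices $k<K$, $K$ being the least index with $\alpha_K(x)=0$ (so $\mathcal S_g(0)=0$). Consider, for $x\in\mathbb R$, Chowla's series and Wilton's series $$\varphi_1(x)=\sum_{n\ge1}\frac{B_1(nx)}{n},\qquad \mathcal W(x)=\mathcal S_{\log(1/\cdot)}(\{x\}),$$ convergence of a series being understood as convergence of the sequence of its partial sums. A Wilton point is an irrational number at which the series $\mathcal W$ converges. Finally let $$A(\lambda)=\int_0^\infty\{t\}\{\lambda t\}\frac{dt}{t^2}\quad(\lambda\ge0),\qquad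 F(x)=\frac{x+1}{2}A(1)-A(x)-\frac x2\log x\quad(x>0),\qquad G(x)=\mathcal S_F(\{x\})\quad(x\in\mathbb R).$$ Theorem. 1. For every real $x$, the series $\varphi_1(x)$ converges if and only if the series $\mathcal W(x)$ converges, and this happens if and only if $x$ is rational or a Wilton point. 2. The series defining $G(x)$ converges absolutely for every real $x$, and at every point $x$ of convergence of $\varphi_1$ and $\mathcal W$ one has $\varphi_1(x)=-\tfrac12\mathcal W(x)+G(x)$. Thus $G$ extends $\varphi_1+\tfrac12\mathcal W$ to $\mathbb R$. 3. The function $G$ is $1$-periodic, bounded, continuous at every irrational number, and has a jump discontinuity at every rational number (both one-sided limits exist and are different). More precisely, if $r$ is a rational number with denominator $q$ in lowest terms, then $$\lim_{x\to r^+}G(x)=G(r)+\frac{A(1)}{2q},\qquad \lim_{x\to r^-}G(x)=G(r)-\frac{A(1)}{2q}.$$ -/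

import Mathlib

open Filter Topology MeasureTheory

namespace ChowlaWilton

noncomputable section

/-- The normalised first Bernoulli function: `{x} - 1/2` off the integers, `0` on the integers. -/
def B1 (x : ℝ) : ℝ := if Int.fract x = 0 then 0 else Int.fract x - 1 / 2

/-- The Gauss map `α(x) = {1/x}`. (With Lean's `1 / 0 = 0` one has `gauss 0 = 0`.) -/
def gauss (x : ℝ) : ℝ := Int.fract (1 / x)

/-- The iterates `α_k` of the Gauss map. If `x ∈ [0,1)` is rational of depth `K` (the length of its
continued fraction), then `α_k x ≠ 0` for `k < K` and `α_k x = 0` for `k ≥ K`; if `x ∈ (0,1)` is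
irrational, then `α_k x ≠ 0` for all `k`. -/
def gaussIter (k : ℕ) (x : ℝ) : ℝ := gauss^[k] x

/-- `betaPrev k x` is `β_{k-1}(x) = α_0(x) ⋯ α_{k-1}(x)`; in particular `betaPrev 0 x = 1`. -/
def betaPrev (k : ℕ) (x : ℝ) : ℝ := ∏ i ∈ Finset.range k, gaussIter i x

/-- The `k`-th term `(-1)^k β_{k-1}(x) g(α_k(x))` of the series `S_g` at `x ∈ [0,1)`. For `x` of
finite depth `K` the sum is limited to the indices `k < K`, that is, to those with `α_k(x) ≠ 0`. -/
def gaussTerm (g : ℝ → ℝ) (x : ℝ) (k : ℕ) : ℝ :=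
  if gaussIter k x = 0 then 0 else (-1) ^ k * betaPrev k x * g (gaussIter k x)

/-- Chowla's series `φ₁(x) = ∑_{n ≥ 1} B₁(n x) / n` converges to `s` (limit of partial sums). -/
def ChowlaHasSum (x s : ℝ) : Prop :=
  Tendsto (fun N : ℕ => ∑ n ∈ Finset.Icc 1 N, B1 (n * x) / n) atTop (𝓝 s)

/-- Wilton's series `𝒲(x) = ∑_{k ≥ 0} (-1)^k β_{k-1}({x}) log (1 / α_k({x}))` converges to `w`
(limit of partial sums). -/
def WiltonHasSum (x w : ℝ) : Prop :=
  Tendsto (fun N : ℕ => ∑ k ∈ Finset.range N,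
    gaussTerm (fun y => Real.log (1 / y)) (Int.fract x) k) atTop (𝓝 w)

/-- Wilton points: the irrational numbers at which Wilton's series converges. -/
def IsWiltonPoint (x : ℝ) : Prop := Irrational x ∧ ∃ w, WiltonHasSum x w

/-- The multiplicative autocorrelation function of the fractional part,
`A(l) = ∫_0^∞ {t} {l t} dt / t²`. -/
def autocorr (l : ℝ) : ℝ := ∫ t in Set.Ioi (0 : ℝ), Int.fract t * Int.fract (l * t) / t ^ 2

/-- The integral defining `autocorr l` converges absolutely for every `l ≥ 0`. -/
theorem integrableOn_autocorr (l : ℝ) (hl : 0 ≤ l) :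
    IntegrableOn (fun t : ℝ => Int.fract t * Int.fract (l * t) / t ^ 2) (Set.Ioi 0) := by
  have hm : Measurable (fun t : ℝ => Int.fract t * Int.fract (l * t) / t ^ 2) :=
    (measurable_fract.mul (measurable_fract.comp (measurable_const_mul l))).div
      (measurable_id.pow_const 2)
  have hle : ∀ y : ℝ, 0 ≤ y → Int.fract y ≤ y := fun y hy => by
    have h := Int.floor_nonneg.2 hy
    have h' : (0 : ℝ) ≤ (⌊y⌋ : ℝ) := by exact_mod_cast h
    have := Int.floor_add_fract y
    linarith
  rw [← Set.Ioc_union_Ioi_eq_Ioi (zero_le_one : (0 : ℝ) ≤ 1)]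
  refine IntegrableOn.union ?_ ?_
  · refine Measure.integrableOn_of_bounded (M := l) (by simp) hm.aestronglyMeasurable ?_
    refine (ae_restrict_iff' measurableSet_Ioc).2 (Eventually.of_forall fun t ht => ?_)
    have h0 : 0 < t := ht.1
    rw [Real.norm_of_nonneg (div_nonneg (mul_nonneg (Int.fract_nonneg _) (Int.fract_nonneg _))
      (by positivity)), div_le_iff₀ (by positivity)]
    calc Int.fract t * Int.fract (l * t) ≤ t * (l * t) :=
          mul_le_mul (hle t h0.le) (hle _ (by positivity)) (Int.fract_nonneg _) h0.le
      _ = l * t ^ 2 := by ring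
  · have hi : IntegrableOn (fun t : ℝ => t ^ (-2 : ℝ)) (Set.Ioi 1) :=
      integrableOn_Ioi_rpow_of_lt (by norm_num) one_pos
    refine Integrable.mono' hi hm.aestronglyMeasurable ?_
    refine (ae_restrict_iff' measurableSet_Ioi).2 (Eventually.of_forall fun t ht => ?_)
    have h0 : 0 < t := lt_trans one_pos ht
    rw [Real.norm_of_nonneg (div_nonneg (mul_nonneg (Int.fract_nonneg _) (Int.fract_nonneg _))
      (by positivity)), Real.rpow_neg h0.le, Real.rpow_two, div_eq_mul_inv]
    have : Int.fract t * Int.fract (l * t) ≤ 1 :=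
      mul_le_one₀ (Int.fract_lt_one _).le (Int.fract_nonneg _) (Int.fract_lt_one _).le
    exact mul_le_of_le_one_left (by positivity) this

/-- `F(x) = (x+1)/2 · A(1) - A(x) - (x/2) log x`. -/
def F (x : ℝ) : ℝ := (x + 1) / 2 * autocorr 1 - autocorr x - x / 2 * Real.log x

/-- `G(x) = S_F({x})`, that is, `∑_k (-1)^k β_{k-1}({x}) F(α_k({x}))`. -/
def G (x : ℝ) : ℝ := ∑' k, gaussTerm F (Int.fract x) k

/-- `f` has a jump discontinuity at `a`: both one-sided limits exist and they are different. -/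
def IsJumpDiscontinuityAt (f : ℝ → ℝ) (a : ℝ) : Prop :=
  ∃ l r : ℝ, Tendsto f (𝓝[<] a) (𝓝 l) ∧ Tendsto f (𝓝[>] a) (𝓝 r) ∧ l ≠ r

end

end ChowlaWilton

namespace ChowlaWilton

noncomputable section

/-! Everything rests on an approximate functional equation (`approx_functional_equation`). Write φ_N
for the partial sums of Chowla's series. For 0 < x ≤ 1 and M = ⌊xN⌋ > 0, φ_N(x) + x φ_M(1/x) equals
F(x) + (1/2) log x up to 4/M. It comes from computing the truncated integral of {t}{xt}/t² over (0,
N] exactly: expanding the floors into indicators produces the double sum of 1/max(n, m/x), which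
splits along m = nx into lattice point counts yielding φ_N(x) and φ_M(1/x). The same identity at x =
1, where Chowla's sums vanish, evaluates the logarithmic sums and so plays the role of Stirling's
formula.

Iterating along the Gauss map, with N_0 = N and N_{k+1} = ⌊α_k N_k⌋, expresses φ_N(x) as a partial
sum of G - 𝒲/2 plus the remainder ±β_{K-1} φ_{N_K}(α_K), with an error tending to 0 as N grows,
uniformly in the admissible K (`abs_chowlaSum_sub_le_tsum`, `tendsto_error`). At irrational x, if 𝒲
converges, take K last with N_K > 0: the remainder is at most β_{K-1}(1 + log(1/α_K)), which tends
to 0. Conversely, if φ₁ converges, choose for each K some N with N_K = 1: the remainder is at most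
β_{K-1}. At rational x, exact functional equations and induction along the continued fraction
suffice.

For G, geometric decay of β_k and boundedness of F on [0,1] give absolute convergence and
boundedness; dominated convergence gives continuity at irrationals. The relation G(x) = F(x) - x
G(1/x) on (0,1), with F(0) = A(1)/2 and F(1) = 0, gives the jump at the integers and transports it
to every rational. -/

/-! ### Truncated autocorrelation integrals -/

/-- The partial sums of Chowla's series. -/
def chowlaSum (N : ℕ) (x : ℝ) : ℝ := ∑ n ∈ Finset.Icc 1 N, B1 (n * x) / n

/-- The integral defining `autocorr`, truncated at `T`. -/
def truncAutocorr (T l : ℝ) : ℝ :=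
  ∫ t in Set.Ioc (0 : ℝ) T, Int.fract t * Int.fract (l * t) / t ^ 2

theorem abs_autocorr_sub_truncAutocorr_le {l T : ℝ} (hl : 0 ≤ l) (hT : 0 < T) :
    |autocorr l - truncAutocorr T l| ≤ 1 / T := by
  have hi := integrableOn_autocorr l hl
  have hI : IntegrableOn (fun t : ℝ => t ^ (-2 : ℝ)) (Set.Ioi T) :=
    integrableOn_Ioi_rpow_of_lt (by norm_num) hT
  have hsplit : autocorr l - truncAutocorr T l
      = ∫ t in Set.Ioi T, Int.fract t * Int.fract (l * t) / t ^ 2 := by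
    unfold autocorr truncAutocorr
    rw [← Set.Ioc_union_Ioi_eq_Ioi hT.le,
      setIntegral_union (Set.Ioc_disjoint_Ioi le_rfl) measurableSet_Ioi
        (hi.mono_set Set.Ioc_subset_Ioi_self) (hi.mono_set (Set.Ioi_subset_Ioi hT.le))]
    ring
  rw [hsplit, ← Real.norm_eq_abs]
  refine (norm_integral_le_of_norm_le (g := fun t : ℝ => t ^ (-2 : ℝ)) hI ?_).trans ?_
  · refine (ae_restrict_iff' measurableSet_Ioi).2 (Eventually.of_forall fun t ht => ?_)
    have h0 : 0 < t := lt_trans hT ht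
    rw [Real.norm_of_nonneg (div_nonneg (mul_nonneg (Int.fract_nonneg _) (Int.fract_nonneg _))
      (by positivity)), Real.rpow_neg h0.le, Real.rpow_two, div_eq_mul_inv]
    exact mul_le_of_le_one_left (by positivity)
      (mul_le_one₀ (Int.fract_lt_one _).le (Int.fract_nonneg _) (Int.fract_lt_one _).le)
  · rw [integral_Ioi_rpow_of_lt (by norm_num) hT]
    norm_num [Real.rpow_neg_one]

theorem integral_indicator_Ici {f : ℝ → ℝ} {a T : ℝ} (ha : 0 < a) (haT : a ≤ T)
    (hf : ContinuousOn f (Set.Icc a T)) :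
    IntegrableOn ((Set.Ici a).indicator f) (Set.Ioc 0 T) ∧
      ∫ t in Set.Ioc 0 T, (Set.Ici a).indicator f t = ∫ t in a..T, f t := by
  have hs : Set.Ioc 0 T ∩ Set.Ici a = Set.Icc a T := by
    ext t; simp only [Set.mem_inter_iff, Set.mem_Ioc, Set.mem_Ici, Set.mem_Icc]
    constructor
    · rintro ⟨⟨_, h⟩, h'⟩; exact ⟨h', h⟩
    · rintro ⟨h, h'⟩; exact ⟨⟨ha.trans_le h, h'⟩, h⟩
  constructor
  · rw [integrableOn_indicator_iff measurableSet_Ici, Set.inter_comm, hs]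
    exact hf.integrableOn_Icc
  · rw [setIntegral_indicator measurableSet_Ici, hs, integral_Icc_eq_integral_Ioc,
      intervalIntegral.integral_of_le haT]

theorem integral_indicator_inv {a T : ℝ} (ha : 0 < a) (haT : a ≤ T) :
    IntegrableOn ((Set.Ici a).indicator fun t => 1 / t) (Set.Ioc 0 T) ∧
      ∫ t in Set.Ioc 0 T, (Set.Ici a).indicator (fun t => 1 / t) t = Real.log (T / a) := by
  have hf : ContinuousOn (fun t : ℝ => 1 / t) (Set.Icc a T) :=
    continuousOn_const.div continuousOn_id fun t ht => (ha.trans_le ht.1).ne'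
  refine ⟨(integral_indicator_Ici ha haT hf).1, ?_⟩
  rw [(integral_indicator_Ici ha haT hf).2, integral_one_div_of_pos ha (ha.trans_le haT)]

theorem integral_indicator_inv_sq {a T : ℝ} (ha : 0 < a) (haT : a ≤ T) :
    IntegrableOn ((Set.Ici a).indicator fun t => 1 / t ^ 2) (Set.Ioc 0 T) ∧
      ∫ t in Set.Ioc 0 T, (Set.Ici a).indicator (fun t => 1 / t ^ 2) t = 1 / a - 1 / T := by
  have hf : ContinuousOn (fun t : ℝ => 1 / t ^ 2) (Set.Icc a T) :=
    continuousOn_const.div (continuousOn_id.pow 2) fun t ht => pow_ne_zero 2 (ha.trans_le ht.1).ne'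
  refine ⟨(integral_indicator_Ici ha haT hf).1, ?_⟩
  rw [(integral_indicator_Ici ha haT hf).2]
  have := intervalIntegral.integral_eq_sub_of_hasDerivAt_of_le (f := fun t : ℝ => - t⁻¹)
    (f' := fun t => 1 / t ^ 2) haT ?_ ?_ ?_
  · rw [this]; simp only [one_div]; ring
  · exact (continuousOn_id.inv₀ fun t ht => (ha.trans_le ht.1).ne').neg
  · intro t ht
    have := (hasDerivAt_inv (ha.trans ht.1).ne').neg
    simp only [neg_neg] at this
    rw [one_div]
    exact this
  · exact (Set.uIcc_of_le haT ▸ hf).intervalIntegrable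

theorem floor_eq_sum_indicator {y : ℝ} (hy : 0 ≤ y) {M : ℕ} (hM : y < M + 1) :
    ((⌊y⌋ : ℤ) : ℝ) = ∑ m ∈ Finset.Icc 1 M, if (m : ℝ) ≤ y then (1 : ℝ) else 0 := by
  rw [Finset.sum_ite, Finset.sum_const_zero, add_zero, Finset.sum_const, nsmul_eq_mul, mul_one]
  have : (Finset.Icc 1 M).filter (fun m : ℕ => (m : ℝ) ≤ y) = Finset.Icc 1 ⌊y⌋₊ := by
    ext m
    simp only [Finset.mem_filter, Finset.mem_Icc, ← Nat.le_floor_iff hy]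
    have : ⌊y⌋₊ < M + 1 := by
      rw [Nat.floor_lt hy]; exact_mod_cast hM
    omega
  rw [this, Nat.card_Icc, Nat.add_sub_cancel, natCast_floor_eq_intCast_floor hy]

/-- Expand (t - ⌊t⌋)(xt - ⌊xt⌋)/t². On (0, N] each floor is a finite sum of indicators of the
half-lines t ≥ n or t ≥ m/x, and products of these are indicators of t ≥ max(n, m/x), so only
integrals of 1, 1/t and 1/t² remain. -/
theorem truncAutocorr_eq {x : ℝ} (hx : 0 < x) (N : ℕ) :
    truncAutocorr N x = x * N - x * ∑ n ∈ Finset.Icc 1 N, Real.log (N / n)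
      - ∑ m ∈ Finset.Icc 1 ⌊x * N⌋₊, Real.log (N / (m / x))
      + ∑ n ∈ Finset.Icc 1 N, ∑ m ∈ Finset.Icc 1 ⌊x * N⌋₊,
          (1 / max (n : ℝ) (m / x) - 1 / N) := by
  set M := ⌊x * N⌋₊ with hM
  have hn : ∀ n ∈ Finset.Icc 1 N, (0 : ℝ) < n ∧ (n : ℝ) ≤ N := fun n h => by
    rw [Finset.mem_Icc] at h; exact ⟨by exact_mod_cast h.1, by exact_mod_cast h.2⟩
  have hm : ∀ m ∈ Finset.Icc 1 M, (0 : ℝ) < m / x ∧ (m : ℝ) / x ≤ N := fun m h => by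
    rw [Finset.mem_Icc] at h
    refine ⟨div_pos (by exact_mod_cast h.1) hx, ?_⟩
    rw [div_le_iff₀ hx, mul_comm]
    exact (Nat.le_floor_iff (by positivity)).1 h.2
  have hnm : ∀ n ∈ Finset.Icc 1 N, ∀ m ∈ Finset.Icc 1 M,
      (0 : ℝ) < max (n : ℝ) (m / x) ∧ max (n : ℝ) (m / x) ≤ N := fun n h m h' =>
    ⟨lt_max_of_lt_left (hn n h).1, max_le (hn n h).2 (hm m h').2⟩
  have hpt : ∀ t ∈ Set.Ioc (0 : ℝ) N, Int.fract t * Int.fract (x * t) / t ^ 2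
      = x - x * ∑ n ∈ Finset.Icc 1 N, (Set.Ici (n : ℝ)).indicator (fun t => 1 / t) t
        - ∑ m ∈ Finset.Icc 1 M, (Set.Ici ((m : ℝ) / x)).indicator (fun t => 1 / t) t
        + ∑ n ∈ Finset.Icc 1 N, ∑ m ∈ Finset.Icc 1 M,
            (Set.Ici (max (n : ℝ) (m / x))).indicator (fun t => 1 / t ^ 2) t := by
    intro t ht
    have ht0 : 0 < t := ht.1
    have h1 : ((⌊t⌋ : ℤ) : ℝ) * (1 / t)
        = ∑ n ∈ Finset.Icc 1 N, (Set.Ici (n : ℝ)).indicator (fun t => 1 / t) t := by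
      rw [floor_eq_sum_indicator ht0.le (M := N) (by linarith [ht.2]), Finset.sum_mul]
      refine Finset.sum_congr rfl fun n _ => ?_
      simp only [Set.indicator_apply, Set.mem_Ici]
      split_ifs <;> simp
    have hxt : x * t < M + 1 := by
      have : x * t ≤ x * N := mul_le_mul_of_nonneg_left ht.2 hx.le
      exact this.trans_lt (Nat.lt_floor_add_one _)
    have hfl := floor_eq_sum_indicator (by positivity : 0 ≤ x * t) hxt
    have h2 : ((⌊x * t⌋ : ℤ) : ℝ) * (1 / t)
        = ∑ m ∈ Finset.Icc 1 M, (Set.Ici ((m : ℝ) / x)).indicator (fun t => 1 / t) t := by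
      rw [hfl, Finset.sum_mul]
      refine Finset.sum_congr rfl fun m _ => ?_
      simp only [Set.indicator_apply, Set.mem_Ici, div_le_iff₀ hx, mul_comm t x]
      split_ifs <;> simp
    have h3 : ((⌊t⌋ : ℤ) : ℝ) * ((⌊x * t⌋ : ℤ) : ℝ) * (1 / t ^ 2)
        = ∑ n ∈ Finset.Icc 1 N, ∑ m ∈ Finset.Icc 1 M,
            (Set.Ici (max (n : ℝ) (m / x))).indicator (fun t => 1 / t ^ 2) t := by
      rw [hfl, floor_eq_sum_indicator ht0.le (M := N) (by linarith [ht.2]),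
        Finset.sum_mul_sum, Finset.sum_mul]
      refine Finset.sum_congr rfl fun n _ => ?_
      rw [Finset.sum_mul]
      refine Finset.sum_congr rfl fun m _ => ?_
      simp only [Set.indicator_apply, Set.mem_Ici, max_le_iff, div_le_iff₀ hx, mul_comm t x]
      split_ifs <;> simp_all
    rw [← h1, ← h2, ← h3]
    unfold Int.fract
    field_simp
    ring
  have i1 : IntegrableOn (fun t => ∑ n ∈ Finset.Icc 1 N,
      (Set.Ici (n : ℝ)).indicator (fun t => 1 / t) t) (Set.Ioc 0 (N : ℝ)) :=
    integrable_finsetSum _ fun n h => (integral_indicator_inv (hn n h).1 (hn n h).2).1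
  have i2 : IntegrableOn (fun t => ∑ m ∈ Finset.Icc 1 M,
      (Set.Ici ((m : ℝ) / x)).indicator (fun t => 1 / t) t) (Set.Ioc 0 (N : ℝ)) :=
    integrable_finsetSum _ fun m h => (integral_indicator_inv (hm m h).1 (hm m h).2).1
  have i3' : ∀ n ∈ Finset.Icc 1 N, IntegrableOn (fun t => ∑ m ∈ Finset.Icc 1 M,
      (Set.Ici (max (n : ℝ) (m / x))).indicator (fun t => 1 / t ^ 2) t) (Set.Ioc 0 (N : ℝ)) :=
    fun n h => integrable_finsetSum _ fun m h' =>
      (integral_indicator_inv_sq (hnm n h m h').1 (hnm n h m h').2).1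
  have i3 : IntegrableOn (fun t => ∑ n ∈ Finset.Icc 1 N, ∑ m ∈ Finset.Icc 1 M,
      (Set.Ici (max (n : ℝ) (m / x))).indicator (fun t => 1 / t ^ 2) t) (Set.Ioc 0 (N : ℝ)) :=
    integrable_finsetSum _ i3'
  have i0 : IntegrableOn (fun _ : ℝ => x) (Set.Ioc 0 (N : ℝ)) := by simp
  have i01 : IntegrableOn (fun t => x - x * ∑ n ∈ Finset.Icc 1 N,
      (Set.Ici (n : ℝ)).indicator (fun t => 1 / t) t) (Set.Ioc 0 (N : ℝ)) :=
    i0.sub (i1.const_mul x)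
  have i012 : IntegrableOn (fun t => x - x * ∑ n ∈ Finset.Icc 1 N,
      (Set.Ici (n : ℝ)).indicator (fun t => 1 / t) t - ∑ m ∈ Finset.Icc 1 M,
      (Set.Ici ((m : ℝ) / x)).indicator (fun t => 1 / t) t) (Set.Ioc 0 (N : ℝ)) :=
    i01.sub i2
  unfold truncAutocorr
  rw [setIntegral_congr_fun measurableSet_Ioc hpt, integral_add i012 i3, integral_sub i01 i2,
    integral_sub i0 (i1.const_mul x),
    integral_const_mul, integral_finsetSum _ i3',
    integral_finsetSum _ fun n h => (integral_indicator_inv (hn n h).1 (hn n h).2).1,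
    integral_finsetSum _ fun m h => (integral_indicator_inv (hm m h).1 (hm m h).2).1]
  congr 1
  · congr 1
    · congr 1
      · simp [mul_comm]
      · congr 1
        exact Finset.sum_congr rfl fun n h => (integral_indicator_inv (hn n h).1 (hn n h).2).2
    · exact Finset.sum_congr rfl fun m h => (integral_indicator_inv (hm m h).1 (hm m h).2).2
  · refine Finset.sum_congr rfl fun n h => ?_
    rw [integral_finsetSum _ fun m h' =>
      (integral_indicator_inv_sq (hnm n h m h').1 (hnm n h m h').2).1]
    exact Finset.sum_congr rfl fun m h' =>
      (integral_indicator_inv_sq (hnm n h m h').1 (hnm n h m h').2).2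

/-! ### Counting with half weights -/

/-- The indicator of `a < b`, with value `1 / 2` if `a = b`. -/
def halfWeight (a b : ℝ) : ℝ := if a < b then 1 else if a = b then 1 / 2 else 0

/-- Halving the endpoint's weight matches the normalisation of `B1` at the integers, so one formula
covers integral and non-integral y. -/
theorem sum_halfWeight {y : ℝ} (hy : 0 < y) {M : ℕ} (hM : y < M + 1) :
    ∑ m ∈ Finset.Icc 1 M, halfWeight m y = y - 1 / 2 - B1 y := by
  have hfl := floor_eq_sum_indicator hy.le hM
  have hff := Int.floor_add_fract y
  have hw : ∀ m : ℕ, halfWeight m y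
      = (if (m : ℝ) ≤ y then (1 : ℝ) else 0) - if (m : ℝ) = y then 1 / 2 else 0 := by
    intro m
    unfold halfWeight
    rcases lt_trichotomy (m : ℝ) y with h | h | h
    · simp [h, h.le, h.ne]
    · simp [h]; norm_num
    · simp [h.not_gt, h.not_ge, h.ne']
  simp only [hw]
  rw [Finset.sum_sub_distrib, ← hfl]
  unfold B1
  split_ifs with h
  · have hyf : y = ((⌊y⌋₊ : ℕ) : ℝ) := by
      rw [natCast_floor_eq_intCast_floor hy.le]; linarith
    have : ∑ m ∈ Finset.Icc 1 M, (if (m : ℝ) = y then (1 / 2 : ℝ) else 0) = 1 / 2 := by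
      rw [Finset.sum_eq_single ⌊y⌋₊]
      · rw [if_pos hyf.symm]
      · intro b _ hb
        rw [if_neg]
        intro hb'
        apply hb
        rw [hyf] at hb'
        exact_mod_cast hb'
      · intro hb
        exfalso; apply hb
        rw [Finset.mem_Icc]
        rw [hyf] at hy hM
        constructor
        · exact_mod_cast hy
        · have : ⌊y⌋₊ < M + 1 := by exact_mod_cast hM
          omega
    rw [this]; linarith
  · have : ∑ m ∈ Finset.Icc 1 M, (if (m : ℝ) = y then (1 / 2 : ℝ) else 0) = 0 := by
      refine Finset.sum_eq_zero fun m _ => if_neg fun hm => h ?_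
      rw [← hm]; simp
    rw [this]; linarith

/-- Sharing the line b = ax equally between its two sides makes the splitting symmetric under
exchanging x with 1/x. -/
theorem one_div_max_eq {x a b : ℝ} (hx : 0 < x) (ha : 0 < a) (hb : 0 < b) :
    1 / max a (b / x) = halfWeight b (a * x) / a + x * (halfWeight a (b * (1 / x)) / b) := by
  unfold halfWeight
  have e : b * (1 / x) = b / x := by ring
  rw [e]
  rcases lt_trichotomy a (b / x) with h | h | h
  · have h' : a * x < b := (lt_div_iff₀ hx).1 h
    rw [max_eq_right h.le, if_neg h'.not_gt, if_neg h'.ne', if_pos h]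
    field_simp; ring
  · have h' : a * x = b := (eq_div_iff hx.ne').1 h
    subst h'
    have : a * x / x = a := by field_simp
    simp [this]
    field_simp; norm_num
  · have h' : b < a * x := (div_lt_iff₀ hx).1 h
    rw [max_eq_left h.le, if_pos h', if_neg h.not_gt, if_neg h.ne']
    ring

theorem sum_one_div_max {x : ℝ} (hx : 0 < x) (N : ℕ) :
    ∑ n ∈ Finset.Icc 1 N, ∑ m ∈ Finset.Icc 1 ⌊x * N⌋₊, 1 / max (n : ℝ) (m / x)
      = x * N - (harmonic N : ℝ) / 2 - chowlaSum N x
        + (⌊x * N⌋₊ - x * (harmonic ⌊x * N⌋₊ : ℝ) / 2 - x * chowlaSum ⌊x * N⌋₊ (1 / x)) := by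
  set M := ⌊x * N⌋₊ with hM
  have hn : ∀ n ∈ Finset.Icc 1 N, (0 : ℝ) < n ∧ (n : ℝ) ≤ N := fun n h => by
    rw [Finset.mem_Icc] at h; exact ⟨by exact_mod_cast h.1, by exact_mod_cast h.2⟩
  have hm : ∀ m ∈ Finset.Icc 1 M, (0 : ℝ) < m ∧ (m : ℝ) * (1 / x) ≤ N := fun m h => by
    rw [Finset.mem_Icc] at h
    refine ⟨by exact_mod_cast h.1, ?_⟩
    rw [mul_one_div, div_le_iff₀ hx, mul_comm]
    exact (Nat.le_floor_iff (by positivity)).1 h.2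
  have hH : ∀ K : ℕ, (harmonic K : ℝ) = ∑ n ∈ Finset.Icc 1 K, (1 : ℝ) / n := by
    intro K; rw [harmonic_eq_sum_Icc]; push_cast; simp [one_div]
  have e1 : ∑ n ∈ Finset.Icc 1 N, ∑ m ∈ Finset.Icc 1 M, 1 / max (n : ℝ) (m / x)
      = (∑ n ∈ Finset.Icc 1 N, (∑ m ∈ Finset.Icc 1 M, halfWeight m (n * x)) / n)
        + ∑ m ∈ Finset.Icc 1 M, x * ((∑ n ∈ Finset.Icc 1 N, halfWeight n (m * (1 / x))) / m) := by
    simp only [Finset.sum_div, Finset.mul_sum]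
    rw [Finset.sum_comm (s := Finset.Icc 1 M), ← Finset.sum_add_distrib]
    refine Finset.sum_congr rfl fun n h => ?_
    rw [← Finset.sum_add_distrib]
    exact Finset.sum_congr rfl fun m h' => one_div_max_eq hx (hn n h).1 (hm m h').1
  rw [e1]
  have hc : ∀ K : ℕ, ∑ n ∈ Finset.Icc 1 K, (1 : ℝ) = K := by intro K; simp
  congr 1
  · have : ∀ n ∈ Finset.Icc 1 N, (∑ m ∈ Finset.Icc 1 M, halfWeight m (n * x)) / n
        = x * 1 - (1 : ℝ) / n / 2 - B1 (n * x) / n := by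
      intro n h
      obtain ⟨h1, h2⟩ := hn n h
      rw [sum_halfWeight (by positivity)]
      · field_simp
      · have : (n : ℝ) * x ≤ x * N := by nlinarith
        exact this.trans_lt (Nat.lt_floor_add_one _)
    rw [Finset.sum_congr rfl this, Finset.sum_sub_distrib, Finset.sum_sub_distrib,
      ← Finset.mul_sum, ← Finset.sum_div, ← hH, hc]
    rfl
  · have : ∀ m ∈ Finset.Icc 1 M,
        x * ((∑ n ∈ Finset.Icc 1 N, halfWeight n (m * (1 / x))) / m)
        = 1 - x * ((1 : ℝ) / m) / 2 - x * (B1 (m * (1 / x)) / m) := by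
      intro m h
      obtain ⟨h1, h2⟩ := hm m h
      rw [sum_halfWeight (by positivity) (by linarith)]
      field_simp
    rw [Finset.sum_congr rfl this, Finset.sum_sub_distrib, Finset.sum_sub_distrib,
      ← Finset.mul_sum, ← Finset.sum_div, ← Finset.mul_sum, ← hH, hc]
    rfl

/-! ### Wilton's approximate functional equation -/

theorem B1_add_intCast (x : ℝ) (n : ℤ) : B1 (x + n) = B1 x := by
  simp [B1, Int.fract_add_intCast]

theorem B1_natCast (n : ℕ) : B1 n = 0 := by simp [B1]

theorem abs_B1_le (x : ℝ) : |B1 x| ≤ 1 / 2 := by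
  unfold B1
  split_ifs
  · norm_num
  · rw [abs_le]
    constructor <;> linarith [Int.fract_nonneg x, Int.fract_lt_one x]

theorem chowlaSum_fract (N : ℕ) (x : ℝ) : chowlaSum N (Int.fract x) = chowlaSum N x := by
  refine Finset.sum_congr rfl fun n _ => ?_
  congr 1
  rw [← B1_add_intCast (n * Int.fract x) (n * ⌊x⌋)]
  congr 1
  push_cast
  rw [← mul_add, Int.fract_add_floor]

theorem chowlaSum_natCast (N k : ℕ) : chowlaSum N k = 0 := by
  refine Finset.sum_eq_zero fun n _ => ?_
  rw [← Nat.cast_mul, B1_natCast, zero_div]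

theorem abs_chowlaSum_le (N : ℕ) (x : ℝ) : |chowlaSum N x| ≤ 1 + Real.log N := by
  have h1 : |chowlaSum N x| ≤ (harmonic N : ℝ) := by
    rw [harmonic_eq_sum_Icc]
    push_cast
    refine (Finset.abs_sum_le_sum_abs _ _).trans (Finset.sum_le_sum fun n _ => ?_)
    rw [abs_div, Nat.abs_cast, div_eq_mul_inv]
    exact mul_le_of_le_one_left (by positivity) ((abs_B1_le _).trans (by norm_num))
  exact h1.trans (harmonic_le_one_add_log N)

theorem truncAutocorr_eq_chowlaSum {x : ℝ} (hx : 0 < x) {N : ℕ} (hN : 0 < N) :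
    truncAutocorr N x = x * N - x * ∑ n ∈ Finset.Icc 1 N, Real.log (N / n)
      - ∑ m ∈ Finset.Icc 1 ⌊x * N⌋₊, Real.log (N / (m / x))
      + (x * N - (harmonic N : ℝ) / 2 - chowlaSum N x
        - x * (harmonic ⌊x * N⌋₊ : ℝ) / 2 - x * chowlaSum ⌊x * N⌋₊ (1 / x)) := by
  have hN' : (0 : ℝ) < N := by exact_mod_cast hN
  rw [truncAutocorr_eq hx]
  simp only [Finset.sum_sub_distrib]
  rw [sum_one_div_max hx]
  simp only [Finset.sum_const, Nat.card_Icc, Nat.add_sub_cancel, nsmul_eq_mul]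
  field_simp
  ring

/-- This is the case x = 1 of the preceding identity, where both Chowla sums vanish: an exact
substitute for Stirling's formula, and the origin of A(1) in F. -/
theorem sum_log_div {N : ℕ} (hN : 0 < N) :
    ∑ n ∈ Finset.Icc 1 N, Real.log (N / n)
      = N - (harmonic N : ℝ) / 2 - truncAutocorr N 1 / 2 := by
  have h := truncAutocorr_eq_chowlaSum one_pos hN
  have h1 := chowlaSum_natCast N 1
  rw [Nat.cast_one] at h1
  simp only [one_mul, div_one, Nat.floor_natCast, h1] at h
  linarith

theorem chowlaSum_add_mul_chowlaSum {x : ℝ} (hx : 0 < x) {N : ℕ} (hN : 0 < N)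
    (hM : 0 < ⌊x * N⌋₊) :
    chowlaSum N x + x * chowlaSum ⌊x * N⌋₊ (1 / x)
      = -truncAutocorr N x + x / 2 * truncAutocorr N 1 + truncAutocorr ⌊x * N⌋₊ 1 / 2
        + (1 - x) / 2 * ((harmonic ⌊x * N⌋₊ : ℝ) - harmonic N)
        + (x * N - ⌊x * N⌋₊ - ⌊x * N⌋₊ * Real.log (x * N / ⌊x * N⌋₊)) := by
  have h := truncAutocorr_eq_chowlaSum hx hN
  have h1 := sum_log_div hN
  have h2 := sum_log_div hM
  set M := ⌊x * N⌋₊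
  have hN' : (0 : ℝ) < N := by exact_mod_cast hN
  have hM' : (0 : ℝ) < M := by exact_mod_cast hM
  have h3 : ∑ m ∈ Finset.Icc 1 M, Real.log (N / (m / x))
      = M * Real.log (x * N / M) + ∑ m ∈ Finset.Icc 1 M, Real.log (M / m) := by
    have : ∀ m ∈ Finset.Icc 1 M, Real.log (N / (m / x))
        = Real.log (x * N / M) + Real.log (M / m) := by
      intro m hm
      have hm' : (0 : ℝ) < m := by exact_mod_cast (Finset.mem_Icc.1 hm).1
      rw [← Real.log_mul (by positivity) (by positivity)]
      congr 1
      field_simp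
    rw [Finset.sum_congr rfl this, Finset.sum_add_distrib]
    simp
  rw [h3, h1, h2] at h
  linarith

/-- The sequence H_n - log n decreases while H_n - log(n + 1) increases; the two monotonicities give
the two bounds. -/
theorem abs_harmonic_sub_harmonic_sub_log_le {M N : ℕ} (hM : 0 < M) (hMN : M ≤ N) :
    |(harmonic M : ℝ) - harmonic N - Real.log (M / N)| ≤ 1 / M := by
  have hM' : (0 : ℝ) < M := by exact_mod_cast hM
  have hN' : (0 : ℝ) < N := by exact_mod_cast hM.trans_le hMN
  have h1 := Real.strictAnti_eulerMascheroniSeq'.antitone hMN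
  have h2 := Real.strictMono_eulerMascheroniSeq.monotone hMN
  simp only [Real.eulerMascheroniSeq', Real.eulerMascheroniSeq, hM.ne', (hM.trans_le hMN).ne',
    if_false] at h1 h2
  rw [Real.log_div hM'.ne' hN'.ne']
  have h3 : Real.log (M + 1) - Real.log M ≤ 1 / M := by
    rw [← Real.log_div (by positivity) hM'.ne']
    refine (Real.log_le_sub_one_of_pos (by positivity)).trans (le_of_eq ?_)
    field_simp; ring
  have h4 : Real.log N ≤ Real.log (N + 1) := Real.log_le_log hN' (by linarith)
  rw [abs_le]
  have : (0 : ℝ) ≤ 1 / M := by positivity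
  constructor <;> linarith

theorem approx_functional_equation {x : ℝ} (hx : 0 < x) (hx1 : x ≤ 1) {N : ℕ}
    (hM : 0 < ⌊x * N⌋₊) :
    |chowlaSum N x + x * chowlaSum ⌊x * N⌋₊ (1 / x) - (F x + 1 / 2 * Real.log x)|
      ≤ 4 / ⌊x * N⌋₊ := by
  have hN : 0 < N := by
    rcases Nat.eq_zero_or_pos N with h | h
    · simp [h] at hM
    · exact h
  have hN' : (0 : ℝ) < N := by exact_mod_cast hN
  have hle : ((⌊x * N⌋₊ : ℕ) : ℝ) ≤ x * N := Nat.floor_le (by positivity)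
  have hlt : x * N < (⌊x * N⌋₊ : ℕ) + 1 := Nat.lt_floor_add_one _
  rw [chowlaSum_add_mul_chowlaSum hx hN hM]
  set M := ⌊x * N⌋₊
  have hM' : (0 : ℝ) < M := by exact_mod_cast hM
  have hMN' : (M : ℝ) ≤ N := hle.trans (by nlinarith)
  have hMN : M ≤ N := by exact_mod_cast hMN'
  have hNM : 1 / (N : ℝ) ≤ 1 / M := one_div_le_one_div_of_le hM' hMN'
  have t1 := (abs_autocorr_sub_truncAutocorr_le hx.le hN').trans hNM
  have t2 := (abs_autocorr_sub_truncAutocorr_le zero_le_one hN').trans hNM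
  have t3 := abs_autocorr_sub_truncAutocorr_le zero_le_one hM'
  have t4 := abs_harmonic_sub_harmonic_sub_log_le hM hMN
  have hr : 1 ≤ x * N / M := by rwa [one_le_div hM']
  have l1 : 0 ≤ Real.log (x * N / M) := Real.log_nonneg hr
  have l2 : Real.log (x * N / M) ≤ 1 / M := by
    refine (Real.log_le_sub_one_of_pos (by positivity)).trans ?_
    rw [div_sub_one hM'.ne']
    gcongr
    linarith
  have l3 : 1 - M / (x * N) ≤ Real.log (x * N / M) := by
    have := Real.one_sub_inv_le_log_of_pos (by positivity : 0 < x * N / M)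
    rwa [inv_div] at this
  have l4 : Real.log (M / N) = Real.log x - Real.log (x * N / M) := by
    rw [← Real.log_div hx.ne' (by positivity)]
    congr 1
    field_simp
  rw [l4] at t4
  have d1 : 0 ≤ x * N - M - M * Real.log (x * N / M) := by
    have := Real.log_le_sub_one_of_pos (by positivity : 0 < x * N / M)
    have h := mul_le_mul_of_nonneg_left this hM'.le
    have e : (M : ℝ) * (x * N / M - 1) = x * N - M := by field_simp
    linarith
  -- By 1 - 1/r ≤ log r, the left side is at most (xN - M)²/(xN), where 0 ≤ xN - M < 1 and xN ≥ M.
  have d2 : x * N - M - M * Real.log (x * N / M) ≤ 1 / M := by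
    have h := mul_le_mul_of_nonneg_left l3 hM'.le
    have e : x * N - M - M * (1 - M / (x * N)) = (x * N - M) ^ 2 / (x * N) := by
      field_simp
    have e2 : (x * N - M) ^ 2 / (x * N) ≤ 1 / M := by
      gcongr
      have : 0 ≤ x * N - M := by linarith
      nlinarith
    linarith
  have t5 : |(1 - x) / 2 * ((harmonic M : ℝ) - harmonic N - Real.log x)| ≤ 1 / M := by
    rw [abs_mul, abs_of_nonneg (by linarith : 0 ≤ (1 - x) / 2)]
    have : |(harmonic M : ℝ) - harmonic N - Real.log x| ≤ 2 / M := by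
      have e : (2 : ℝ) / M = 1 / M + 1 / M := by ring
      rw [abs_le] at t4 ⊢
      constructor <;> linarith
    calc (1 - x) / 2 * |(harmonic M : ℝ) - harmonic N - Real.log x|
        ≤ 1 / 2 * (2 / M) := by gcongr; linarith
      _ = 1 / M := by ring
  have t6 : |x / 2 * (autocorr 1 - truncAutocorr N 1)| ≤ 1 / 2 * (1 / M) := by
    rw [abs_mul, abs_of_nonneg (by linarith : 0 ≤ x / 2)]
    gcongr
  -- In units of 1/M the errors are 1 for A(x), 1/2 for each of the two A(1) terms, 1 for the
  -- harmonic numbers and 1 for the rounding of xN.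
  have e4 : (4 : ℝ) / M = 4 * (1 / M) := by ring
  rw [e4]
  unfold F
  have hlog : (1 - x) / 2 * ((harmonic M : ℝ) - harmonic N - Real.log x)
      = (1 - x) / 2 * ((harmonic M : ℝ) - harmonic N) - 1 / 2 * Real.log x
        + x / 2 * Real.log x := by ring
  rw [hlog] at t5
  rw [abs_le] at t1 t3 t5 t6 ⊢
  constructor <;> linarith

/-! ### Regularity of `F` -/

theorem fract_le_self {y : ℝ} (hy : 0 ≤ y) : Int.fract y ≤ y := by
  have h : (0 : ℝ) ≤ (⌊y⌋ : ℝ) := by exact_mod_cast Int.floor_nonneg.2 hy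
  linarith [Int.floor_add_fract y]

theorem autocorr_zero : autocorr 0 = 0 := by simp [autocorr]

theorem autocorr_one_pos : 0 < autocorr 1 := by
  unfold autocorr
  rw [setIntegral_pos_iff_support_of_nonneg_ae]
  · refine lt_of_lt_of_le ?_ (measure_mono (s := Set.Ioo (0 : ℝ) 1) ?_)
    · simp
    · intro t ht
      refine ⟨?_, ht.1⟩
      have : Int.fract t = t := Int.fract_eq_self.2 ⟨ht.1.le, ht.2⟩
      rw [Function.mem_support, one_mul, this]
      have := ht.1
      positivity
  · exact Eventually.of_forall fun t => div_nonneg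
      (mul_nonneg (Int.fract_nonneg _) (Int.fract_nonneg _)) (by positivity)
  · exact integrableOn_autocorr 1 zero_le_one

theorem continuousAt_fract {y : ℝ} (hy : ∀ n : ℤ, (n : ℝ) ≠ y) : ContinuousAt Int.fract y := by
  have h1 : (⌊y⌋ : ℝ) < y := lt_of_le_of_ne (Int.floor_le y) (hy _)
  have h2 := Int.lt_floor_add_one y
  have : (fun z : ℝ => z - ⌊y⌋) =ᶠ[𝓝 y] Int.fract := by
    filter_upwards [Ioo_mem_nhds h1 h2] with z hz
    have : ⌊z⌋ = ⌊y⌋ := Int.floor_eq_iff.2 ⟨hz.1.le, hz.2⟩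
    rw [Int.fract, this]
  exact ContinuousAt.congr (by fun_prop) this

/-- Dominated convergence near l, with majorant l + 1 on (0, 1] and t⁻² beyond. -/
theorem continuousOn_autocorr : ContinuousOn autocorr (Set.Ici 0) := by
  intro l hl
  have hle : ∀ᶠ z in 𝓝[Set.Ici 0] l, 0 ≤ z ∧ z ≤ l + 1 := by
    filter_upwards [self_mem_nhdsWithin,
      mem_nhdsWithin_of_mem_nhds (Iic_mem_nhds (lt_add_one l))] with z h1 h2 using ⟨h1, h2⟩
  have hm : ∀ z : ℝ, Measurable (fun t : ℝ => Int.fract t * Int.fract (z * t) / t ^ 2) := fun z =>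
    (measurable_fract.mul (measurable_fract.comp (measurable_const_mul z))).div
      (measurable_id.pow_const 2)
  have hl0 : (0 : ℝ) ≤ l := hl
  have hdom : IntegrableOn (fun t : ℝ => if t ≤ 1 then l + 1 else t ^ (-2 : ℝ)) (Set.Ioi 0) := by
    rw [← Set.Ioc_union_Ioi_eq_Ioi (zero_le_one : (0 : ℝ) ≤ 1)]
    refine IntegrableOn.union ?_ ?_
    · refine (integrableOn_congr_fun (fun t ht => if_pos ht.2) measurableSet_Ioc).2 ?_
      simp
    · refine (integrableOn_congr_fun (fun t ht => if_neg (not_le.2 ht)) measurableSet_Ioi).2 ?_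
      exact integrableOn_Ioi_rpow_of_lt (by norm_num) one_pos
  refine tendsto_integral_filter_of_dominated_convergence _
    (Eventually.of_forall fun z => (hm z).aestronglyMeasurable) ?_ hdom ?_
  · filter_upwards [hle] with z hz
    refine (ae_restrict_iff' measurableSet_Ioi).2 (Eventually.of_forall fun t ht => ?_)
    have h0 : (0 : ℝ) < t := ht
    rw [Real.norm_of_nonneg (div_nonneg (mul_nonneg (Int.fract_nonneg _) (Int.fract_nonneg _))
      (by positivity))]
    split_ifs
    · rw [div_le_iff₀ (by positivity)]
      calc Int.fract t * Int.fract (z * t) ≤ t * (z * t) :=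
            mul_le_mul (fract_le_self h0.le) (fract_le_self (mul_nonneg hz.1 h0.le))
              (Int.fract_nonneg _) h0.le
        _ = z * t ^ 2 := by ring
        _ ≤ (l + 1) * t ^ 2 := by gcongr; exact hz.2
    · rw [Real.rpow_neg h0.le, Real.rpow_two, div_eq_mul_inv]
      exact mul_le_of_le_one_left (by positivity)
        (mul_le_one₀ (Int.fract_lt_one _).le (Int.fract_nonneg _) (Int.fract_lt_one _).le)
  -- For l > 0 the integrand is continuous in the parameter unless lt is an integer, a null set of
  -- t. For l = 0 this fails for every t, but approaching from z ≥ 0 one has {zt} ≤ zt.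
  · rcases hl0.eq_or_lt with h | h
    · subst h
      refine (ae_restrict_iff' measurableSet_Ioi).2 (Eventually.of_forall fun t ht => ?_)
      have h0 : (0 : ℝ) < t := ht
      have hlim : Tendsto (fun z : ℝ => Int.fract (z * t)) (𝓝[Set.Ici 0] 0) (𝓝 0) := by
        have h1 : Tendsto (fun z : ℝ => z * t) (𝓝[Set.Ici 0] 0) (𝓝 0) := by
          have : Tendsto (fun z : ℝ => z * t) (𝓝 0) (𝓝 (0 * t)) :=
            (continuous_id.mul continuous_const).tendsto 0
          rw [zero_mul] at this
          exact this.mono_left nhdsWithin_le_nhds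
        refine squeeze_zero' (Eventually.of_forall fun _ => Int.fract_nonneg _) ?_ h1
        filter_upwards [self_mem_nhdsWithin] with z hz
        exact fract_le_self (mul_nonneg hz h0.le)
      have := (hlim.const_mul (Int.fract t)).div_const (t ^ 2)
      simpa using this
    · have hnull : ∀ᵐ t : ℝ, t ∉ Set.range (fun n : ℤ => (n : ℝ) / l) :=
        (Set.countable_range _).ae_notMem _
      filter_upwards [ae_restrict_of_ae hnull] with t ht
      have hc : ContinuousAt Int.fract (l * t) := by
        refine continuousAt_fract fun n hn => ht ⟨n, ?_⟩
        simp only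
        rw [hn]; field_simp
      have hc' : ContinuousAt (fun z : ℝ => Int.fract (z * t)) l :=
        ContinuousAt.comp (f := fun z : ℝ => z * t) hc (by fun_prop)
      have : ContinuousAt (fun z : ℝ => Int.fract t * Int.fract (z * t) / t ^ 2) l :=
        (continuousAt_const.mul hc').div_const _
      exact this.tendsto.mono_left nhdsWithin_le_nhds

theorem continuousOn_F : ContinuousOn F (Set.Ici 0) := by
  unfold F
  refine ContinuousOn.sub (ContinuousOn.sub (by fun_prop) continuousOn_autocorr) ?_
  have := (Real.continuous_mul_log.div_const 2).continuousOn (s := Set.Ici 0)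
  refine this.congr fun x _ => by ring

theorem F_zero : F 0 = autocorr 1 / 2 := by simp [F, autocorr_zero]; ring

theorem F_one : F 1 = 0 := by simp [F]

theorem exists_abs_F_le : ∃ C : ℝ, 0 ≤ C ∧ ∀ x ∈ Set.Icc (0 : ℝ) 1, |F x| ≤ C := by
  obtain ⟨C, hC⟩ := isCompact_Icc.exists_bound_of_continuousOn
    (continuousOn_F.mono (Set.Icc_subset_Ici_self : Set.Icc (0 : ℝ) 1 ⊆ _))
  exact ⟨C, (norm_nonneg _).trans (hC 0 (by simp)), hC⟩

/-! ### The Gauss map and the series `S_g` -/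

theorem gaussIter_zero (x : ℝ) : gaussIter 0 x = x := rfl

theorem gaussIter_succ (k : ℕ) (x : ℝ) : gaussIter (k + 1) x = gauss (gaussIter k x) :=
  Function.iterate_succ_apply' gauss k x

theorem gaussIter_succ' (k : ℕ) (x : ℝ) : gaussIter (k + 1) x = gaussIter k (gauss x) :=
  Function.iterate_succ_apply gauss k x

theorem gauss_mem (x : ℝ) : gauss x ∈ Set.Ico (0 : ℝ) 1 :=
  ⟨Int.fract_nonneg _, Int.fract_lt_one _⟩

theorem gaussIter_mem {x : ℝ} (hx : x ∈ Set.Ico (0 : ℝ) 1) (k : ℕ) :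
    gaussIter k x ∈ Set.Ico (0 : ℝ) 1 := by
  cases k with
  | zero => exact hx
  | succ k => rw [gaussIter_succ]; exact gauss_mem _

/-- For x > 0 and n = ⌊1/x⌋ ≥ 1, the product is 1 - nx, and 1 < (n + 1)x ≤ 2nx. -/
theorem mul_gauss_le {x : ℝ} (hx : x ∈ Set.Ico (0 : ℝ) 1) : x * gauss x ≤ 1 / 2 := by
  rcases hx.1.eq_or_lt with h | h
  · rw [← h]; norm_num
  · have h1 : (1 : ℤ) ≤ ⌊1 / x⌋ := by
      rw [Int.le_floor, Int.cast_one, one_le_div h]; exact hx.2.le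
    have h1' : (1 : ℝ) ≤ (⌊1 / x⌋ : ℝ) := by exact_mod_cast h1
    have h2 := Int.lt_floor_add_one (1 / x)
    rw [div_lt_iff₀ h] at h2
    have h3 : x * gauss x = 1 - x * ⌊1 / x⌋ := by
      unfold gauss Int.fract
      field_simp
    rw [h3]
    nlinarith

theorem betaPrev_succ (k : ℕ) (x : ℝ) : betaPrev (k + 1) x = betaPrev k x * gaussIter k x :=
  Finset.prod_range_succ _ _

theorem betaPrev_succ' (k : ℕ) (x : ℝ) : betaPrev (k + 1) x = x * betaPrev k (gauss x) := by
  unfold betaPrev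
  rw [Finset.prod_range_succ', mul_comm]
  simp only [gaussIter_succ', gaussIter_zero]

theorem betaPrev_nonneg {x : ℝ} (hx : x ∈ Set.Ico (0 : ℝ) 1) (k : ℕ) : 0 ≤ betaPrev k x :=
  Finset.prod_nonneg fun i _ => (gaussIter_mem hx i).1

/-- Two consecutive factors contribute at most 1/2 ≤ (3/4)²; the constant 2 leaves room for the
cases k = 0 and k = 1. -/
theorem betaPrev_le {x : ℝ} (hx : x ∈ Set.Ico (0 : ℝ) 1) (k : ℕ) :
    betaPrev k x ≤ 2 * (3 / 4) ^ k := by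
  induction k using Nat.twoStepInduction with
  | zero => simp [betaPrev]
  | one =>
    have := hx.2
    simp [betaPrev, gaussIter_zero]; linarith
  | more k ih _ =>
    rw [betaPrev_succ, betaPrev_succ, gaussIter_succ, mul_assoc]
    have h := mul_gauss_le (gaussIter_mem hx k)
    calc betaPrev k x * (gaussIter k x * gauss (gaussIter k x))
        ≤ (2 * (3 / 4) ^ k) * (1 / 2) :=
          mul_le_mul ih h (mul_nonneg (gaussIter_mem hx k).1 (gauss_mem _).1) (by positivity)
      _ ≤ 2 * (3 / 4) ^ (k + 2) := by
          rw [pow_add]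
          have : (0 : ℝ) ≤ (3 / 4) ^ k := by positivity
          nlinarith

theorem summable_two_mul_geometric : Summable fun k : ℕ => 2 * (3 / 4 : ℝ) ^ k :=
  (summable_geometric_of_lt_one (by norm_num) (by norm_num)).mul_left 2

theorem summable_betaPrev {x : ℝ} (hx : x ∈ Set.Ico (0 : ℝ) 1) :
    Summable fun k => betaPrev k x :=
  Summable.of_nonneg_of_le (betaPrev_nonneg hx) (betaPrev_le hx) summable_two_mul_geometric

theorem fract_mem (x : ℝ) : Int.fract x ∈ Set.Ico (0 : ℝ) 1 :=
  ⟨Int.fract_nonneg _, Int.fract_lt_one _⟩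

/-- The shift behind the functional equations of both G and 𝒲. Terms past the depth of a rational
are 0, so no case distinction is needed. -/
theorem gaussTerm_succ (g : ℝ → ℝ) (x : ℝ) (k : ℕ) :
    gaussTerm g x (k + 1) = -x * gaussTerm g (gauss x) k := by
  unfold gaussTerm
  rw [gaussIter_succ', betaPrev_succ', pow_succ]
  split_ifs
  · simp
  · ring

theorem gaussTerm_zero_left (g : ℝ → ℝ) (k : ℕ) : gaussTerm g 0 k = 0 := by
  cases k with
  | zero => simp [gaussTerm, gaussIter_zero]
  | succ k => rw [gaussTerm_succ]; simp

theorem gaussTerm_zero_right (g : ℝ → ℝ) {x : ℝ} (hx : x ≠ 0) : gaussTerm g x 0 = g x := by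
  simp [gaussTerm, gaussIter_zero, betaPrev, hx]

theorem abs_gaussTerm_le {g : ℝ → ℝ} {C : ℝ} (hC : 0 ≤ C)
    (hg : ∀ x ∈ Set.Icc (0 : ℝ) 1, |g x| ≤ C) {x : ℝ} (hx : x ∈ Set.Ico (0 : ℝ) 1) (k : ℕ) :
    |gaussTerm g x k| ≤ C * (2 * (3 / 4) ^ k) := by
  unfold gaussTerm
  split_ifs
  · rw [abs_zero]; positivity
  · rw [abs_mul, abs_mul, abs_pow, abs_neg, abs_one, one_pow, one_mul,
      abs_of_nonneg (betaPrev_nonneg hx k), mul_comm]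
    exact mul_le_mul (hg _ (Set.Ico_subset_Icc_self (gaussIter_mem hx k))) (betaPrev_le hx k)
      (betaPrev_nonneg hx k) hC

theorem summable_gaussTerm_F {x : ℝ} (hx : x ∈ Set.Ico (0 : ℝ) 1) : Summable (gaussTerm F x) := by
  obtain ⟨C, hC, h⟩ := exists_abs_F_le
  exact Summable.of_norm_bounded (summable_two_mul_geometric.mul_left C)
    fun k => abs_gaussTerm_le hC h hx k

/-! ### The functional equation of `G` -/

theorem G_periodic : Function.Periodic G 1 := fun x => by simp [G]

theorem exists_abs_G_le : ∃ C : ℝ, ∀ x : ℝ, |G x| ≤ C := by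
  obtain ⟨C, hC, h⟩ := exists_abs_F_le
  refine ⟨∑' k : ℕ, C * (2 * (3 / 4 : ℝ) ^ k), fun x => ?_⟩
  exact tsum_of_norm_bounded (f := gaussTerm F (Int.fract x)) (summable_two_mul_geometric.mul_left C).hasSum
    fun k => abs_gaussTerm_le hC h (fract_mem x) k

theorem G_zero : G 0 = 0 := by simp [G, gaussTerm_zero_left]

theorem G_fract (x : ℝ) : G (Int.fract x) = G x := by simp [G]

theorem G_functional_equation {x : ℝ} (hx : x ∈ Set.Ioo (0 : ℝ) 1) :
    G x = F x - x * G (1 / x) := by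
  have hx' : x ∈ Set.Ico (0 : ℝ) 1 := ⟨hx.1.le, hx.2⟩
  have hf : Int.fract x = x := Int.fract_eq_self.2 hx'
  -- Definitional, since the fractional part of 1/x is `gauss x`.
  have : G (1 / x) = ∑' k, gaussTerm F (gauss x) k := rfl
  rw [this, G, hf, (summable_gaussTerm_F hx').tsum_eq_zero_add, gaussTerm_zero_right F hx.1.ne']
  simp only [gaussTerm_succ]
  rw [tsum_mul_left]
  ring

/-! ### Continuity of `G` at the irrational numbers -/

theorem irrational_gauss {x : ℝ} (hx : Irrational x) : Irrational (gauss x) := by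
  unfold gauss Int.fract
  rw [one_div]
  exact hx.inv.sub_intCast _

theorem irrational_gaussIter {x : ℝ} (hx : Irrational x) (k : ℕ) : Irrational (gaussIter k x) := by
  induction k with
  | zero => exact hx
  | succ k ih => rw [gaussIter_succ]; exact irrational_gauss ih

theorem irrational_fract {x : ℝ} (hx : Irrational x) : Irrational (Int.fract x) :=
  hx.sub_intCast _

theorem continuousAt_fract_of_irrational {x : ℝ} (hx : Irrational x) :
    ContinuousAt Int.fract x :=
  continuousAt_fract fun n hn => hx.ne_int n hn.symm

theorem continuousAt_gauss {x : ℝ} (hx : Irrational x) : ContinuousAt gauss x := by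
  have h1 : ContinuousAt (fun y : ℝ => 1 / y) x := continuousAt_const.div continuousAt_id hx.ne_zero
  have h2 : Irrational (1 / x) := by rw [one_div]; exact hx.inv
  exact ContinuousAt.comp (f := fun y : ℝ => 1 / y) (continuousAt_fract_of_irrational h2) h1

theorem continuousAt_gaussIter {x : ℝ} (hx : Irrational x) (k : ℕ) :
    ContinuousAt (gaussIter k) x := by
  induction k with
  | zero => exact continuousAt_id
  | succ k ih =>
    have h : gaussIter (k + 1) = fun y => gauss (gaussIter k y) := funext (gaussIter_succ k)
    rw [h]
    exact ContinuousAt.comp (g := gauss) (continuousAt_gauss (irrational_gaussIter hx k)) ih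

theorem continuousAt_gaussTerm {g : ℝ → ℝ} (hg : ContinuousOn g (Set.Ici 0)) {x : ℝ}
    (hx : Irrational x) (hx' : x ∈ Set.Ico (0 : ℝ) 1) (k : ℕ) :
    ContinuousAt (fun y => gaussTerm g y k) x := by
  have h0 : gaussIter k x ≠ 0 := (irrational_gaussIter hx k).ne_zero
  have hpos : 0 < gaussIter k x := lt_of_le_of_ne (gaussIter_mem hx' k).1 h0.symm
  have hc := continuousAt_gaussIter hx
  have hb : ContinuousAt (betaPrev k) x := by
    have h : betaPrev k = fun y => ∏ i ∈ Finset.range k, gaussIter i y := rfl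
    rw [h]
    exact tendsto_finsetProd _ fun i _ => hc i
  have hgk : ContinuousAt (fun y => g (gaussIter k y)) x :=
    ContinuousAt.comp (hg.continuousAt (Ici_mem_nhds hpos)) (hc k)
  have : ContinuousAt (fun y => (-1) ^ k * betaPrev k y * g (gaussIter k y)) x :=
    (continuousAt_const.mul hb).mul hgk
  refine this.congr ?_
  filter_upwards [(hc k).eventually_ne h0] with y hy
  rw [gaussTerm, if_neg hy]

theorem continuousAt_G {x : ℝ} (hx : Irrational x) : ContinuousAt G x := by
  obtain ⟨C, hC, h⟩ := exists_abs_F_le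
  refine tendsto_tsum_of_dominated_convergence (summable_two_mul_geometric.mul_left C)
    (fun k => ?_) (Eventually.of_forall fun y k => abs_gaussTerm_le hC h (fract_mem y) k)
  exact ContinuousAt.comp (g := fun y => gaussTerm F y k)
    (continuousAt_gaussTerm continuousOn_F (irrational_fract hx) (fract_mem x) k)
    (continuousAt_fract_of_irrational hx)

/-! ### One-sided limits of `G` at the rational numbers -/

/-- Euclid's algorithm: integer translation preserves the denominator, and inverting p/q in (0, 1)
lowers it from q to p. -/
theorem rat_gauss_induction {P : ℚ → Prop} (hint : ∀ (r : ℚ) (n : ℤ), P r → P (r + n))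
    (h0 : P 0) (hstep : ∀ r : ℚ, 0 < r → r < 1 → P r⁻¹ → P r) (r : ℚ) : P r := by
  induction hq : r.den using Nat.strong_induction_on generalizing r with
  | _ q ih =>
    subst hq
    rw [← Int.fract_add_floor r]
    refine hint _ _ ?_
    have hden : (Int.fract r).den = r.den := by
      rw [Int.fract]
      exact Rat.sub_intCast_den r _
    rcases (Int.fract_nonneg r).eq_or_lt with h | h
    · rwa [← h]
    · refine hstep _ h (Int.fract_lt_one r) (ih _ ?_ _ rfl)
      rw [← hden, Rat.den_inv_of_ne_zero h.ne']
      have h1 := Rat.num_lt_denom_iff.2 (Int.fract_lt_one r)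
      have h2 := Rat.num_pos.2 h
      omega

/-- The one-sided limits of `G` at `a` are `G a ± j`. -/
def HasJump (a j : ℝ) : Prop :=
  Tendsto G (𝓝[>] a) (𝓝 (G a + j)) ∧ Tendsto G (𝓝[<] a) (𝓝 (G a - j))

theorem G_sub_intCast (x : ℝ) (n : ℤ) : G (x - n) = G x := by
  simpa using G_periodic.sub_int_mul_eq n (x := x)

theorem HasJump.add_intCast {a j : ℝ} (h : HasJump a j) (n : ℤ) : HasJump (a + n) j := by
  have hc : Tendsto (fun x : ℝ => x - n) (𝓝 (a + n)) (𝓝 a) := by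
    have : Continuous fun x : ℝ => x - n := by fun_prop
    simpa using this.tendsto (a + n)
  have ha : G (a + n) = G a := by rw [← G_sub_intCast _ n, add_sub_cancel_right]
  unfold HasJump
  rw [ha]
  constructor
  · refine (h.1.comp (tendsto_nhdsWithin_iff.2 ⟨hc.mono_left nhdsWithin_le_nhds, ?_⟩)).congr
      fun x => G_sub_intCast x n
    filter_upwards [self_mem_nhdsWithin] with x hx
    exact lt_sub_iff_add_lt.2 (Set.mem_Ioi.1 hx)
  · refine (h.2.comp (tendsto_nhdsWithin_iff.2 ⟨hc.mono_left nhdsWithin_le_nhds, ?_⟩)).congr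
      fun x => G_sub_intCast x n
    filter_upwards [self_mem_nhdsWithin] with x hx
    exact sub_lt_iff_lt_add.2 (Set.mem_Iio.1 hx)

theorem tendsto_one_div_nhdsGT {a : ℝ} (ha : 0 < a) :
    Tendsto (fun x : ℝ => 1 / x) (𝓝[>] a) (𝓝[<] (1 / a)) := by
  have hc : ContinuousAt (fun x : ℝ => 1 / x) a := continuousAt_const.div continuousAt_id ha.ne'
  refine tendsto_nhdsWithin_iff.2 ⟨hc.tendsto.mono_left nhdsWithin_le_nhds, ?_⟩
  filter_upwards [self_mem_nhdsWithin] with x hx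
  exact one_div_lt_one_div_of_lt ha hx

theorem tendsto_one_div_nhdsLT {a : ℝ} (ha : 0 < a) :
    Tendsto (fun x : ℝ => 1 / x) (𝓝[<] a) (𝓝[>] (1 / a)) := by
  have hc : ContinuousAt (fun x : ℝ => 1 / x) a := continuousAt_const.div continuousAt_id ha.ne'
  refine tendsto_nhdsWithin_iff.2 ⟨hc.tendsto.mono_left nhdsWithin_le_nhds, ?_⟩
  filter_upwards [self_mem_nhdsWithin, mem_nhdsWithin_of_mem_nhds (Ioi_mem_nhds ha)] with x hx hx0
  exact one_div_lt_one_div_of_lt (Set.mem_Ioi.1 hx0) (Set.mem_Iio.1 hx)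

/-- Boundedness of G kills x G(1/x) as x → 0⁺, which leaves F(0). -/
theorem tendsto_G_zero_right : Tendsto G (𝓝[>] 0) (𝓝 (autocorr 1 / 2)) := by
  obtain ⟨C, hC⟩ := exists_abs_G_le
  have hF : Tendsto F (𝓝[>] 0) (𝓝 (autocorr 1 / 2)) := by
    rw [← F_zero]
    exact (continuousOn_F 0 Set.self_mem_Ici).mono_left (nhdsWithin_mono _ Set.Ioi_subset_Ici_self)
  have hz : Tendsto (fun x : ℝ => x * G (1 / x)) (𝓝[>] 0) (𝓝 0) := by
    refine squeeze_zero_norm (a := fun x : ℝ => |x| * C) (fun x => ?_) ?_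
    · rw [norm_mul]
      exact mul_le_mul_of_nonneg_left (hC _) (abs_nonneg x)
    · have : Continuous fun x : ℝ => |x| * C := by fun_prop
      simpa using (this.tendsto 0).mono_left nhdsWithin_le_nhds
  have := hF.sub hz
  rw [sub_zero] at this
  refine this.congr' ?_
  filter_upwards [Ioo_mem_nhdsGT (zero_lt_one : (0 : ℝ) < 1)] with x hx
  exact (G_functional_equation hx).symm

theorem tendsto_G_one_right : Tendsto G (𝓝[>] 1) (𝓝 (autocorr 1 / 2)) := by
  have hG : G = fun x => G (x - 1) := funext fun x => by simpa using (G_sub_intCast x 1).symm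
  rw [hG]
  refine tendsto_G_zero_right.comp (tendsto_nhdsWithin_iff.2 ⟨?_, ?_⟩)
  · have : Continuous fun x : ℝ => x - 1 := by fun_prop
    simpa using (this.tendsto 1).mono_left nhdsWithin_le_nhds
  · filter_upwards [self_mem_nhdsWithin] with x hx
    exact sub_pos.2 (Set.mem_Ioi.1 hx)

/-- As x → 1⁻, 1/x → 1⁺ and F(x) → F(1) = 0, so the limit is minus the right-hand limit at 1. -/
theorem tendsto_G_one_left : Tendsto G (𝓝[<] 1) (𝓝 (-(autocorr 1 / 2))) := by
  have hF : Tendsto F (𝓝[<] 1) (𝓝 0) := by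
    rw [← F_one]
    exact (continuousOn_F.continuousAt (Ici_mem_nhds one_pos)).tendsto.mono_left nhdsWithin_le_nhds
  have h1 := tendsto_one_div_nhdsLT (zero_lt_one : (0 : ℝ) < 1)
  rw [one_div_one] at h1
  have hid : Tendsto (fun x : ℝ => x) (𝓝[<] 1) (𝓝 1) := tendsto_id.mono_left nhdsWithin_le_nhds
  have := hF.sub (hid.mul (tendsto_G_one_right.comp h1))
  rw [one_mul, zero_sub] at this
  refine this.congr' ?_
  filter_upwards [Ioo_mem_nhdsLT (zero_lt_one : (0 : ℝ) < 1)] with x hx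
  exact (G_functional_equation hx).symm

theorem hasJump_zero : HasJump 0 (autocorr 1 / 2) := by
  have h : HasJump 1 (autocorr 1 / 2) := by
    have h1 : G 1 = 0 := by rw [← G_zero, ← G_sub_intCast 1 1]; norm_num
    refine ⟨?_, ?_⟩
    · rw [h1, zero_add]; exact tendsto_G_one_right
    · rw [h1, zero_sub]; exact tendsto_G_one_left
  simpa using h.add_intCast (-1)

/-- Inversion exchanges the two sides and the minus sign in -x G(1/x) exchanges them back, so the
jump is multiplied by a > 0. -/
theorem HasJump.of_one_div {a j : ℝ} (ha : a ∈ Set.Ioo (0 : ℝ) 1) (h : HasJump (1 / a) j) :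
    HasJump a (a * j) := by
  have hF : Tendsto F (𝓝 a) (𝓝 (F a)) := continuousOn_F.continuousAt (Ici_mem_nhds ha.1)
  have he : ∀ᶠ x in 𝓝 a, F x - x * G (1 / x) = G x := by
    filter_upwards [Ioo_mem_nhds ha.1 ha.2] with x hx
    exact (G_functional_equation hx).symm
  constructor
  · have hid : Tendsto (fun x : ℝ => x) (𝓝[>] a) (𝓝 a) := tendsto_id.mono_left nhdsWithin_le_nhds
    have := (hF.mono_left nhdsWithin_le_nhds).sub
      (hid.mul (h.2.comp (tendsto_one_div_nhdsGT ha.1)))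
    have e : F a - a * (G (1 / a) - j) = G a + a * j := by rw [G_functional_equation ha]; ring
    rw [e] at this
    exact this.congr' (he.filter_mono nhdsWithin_le_nhds)
  · have hid : Tendsto (fun x : ℝ => x) (𝓝[<] a) (𝓝 a) := tendsto_id.mono_left nhdsWithin_le_nhds
    have := (hF.mono_left nhdsWithin_le_nhds).sub
      (hid.mul (h.1.comp (tendsto_one_div_nhdsLT ha.1)))
    have e : F a - a * (G (1 / a) + j) = G a - a * j := by rw [G_functional_equation ha]; ring
    rw [e] at this
    exact this.congr' (he.filter_mono nhdsWithin_le_nhds)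

theorem hasJump_ratCast (r : ℚ) : HasJump r (autocorr 1 / (2 * r.den)) := by
  induction r using rat_gauss_induction with
  | hint r n h =>
    have hd : (r + n : ℚ).den = r.den := Rat.add_intCast_den r n
    rw [hd]
    have := h.add_intCast n
    push_cast
    exact this
  | h0 => simpa using hasJump_zero
  | hstep r h0 h1 h =>
    have h0' : (0 : ℝ) < r := by exact_mod_cast h0
    have h1' : (r : ℝ) < 1 := by exact_mod_cast h1
    have hn := Rat.num_pos.2 h0
    have hnat : ((r.num.natAbs : ℕ) : ℝ) = r.num := by
      rw [Nat.cast_natAbs, abs_of_pos hn]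
    rw [Rat.den_inv_of_ne_zero h0.ne', hnat, Rat.cast_inv, ← one_div] at h
    have := h.of_one_div ⟨h0', h1'⟩
    have hnR : (0 : ℝ) < r.num := by exact_mod_cast hn
    have hdR : (0 : ℝ) < r.den := by exact_mod_cast r.pos
    -- With r = p/q, the inverse has denominator p, and the factor p/q turns 1/p into 1/q.
    have e : (r : ℝ) * (autocorr 1 / (2 * r.num)) = autocorr 1 / (2 * r.den) := by
      rw [Rat.cast_def]; field_simp
    rwa [e] at this

theorem isJumpDiscontinuityAt_G (r : ℚ) : IsJumpDiscontinuityAt G r := by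
  obtain ⟨h1, h2⟩ := hasJump_ratCast r
  refine ⟨_, _, h2, h1, ?_⟩
  have hd : (0 : ℝ) < r.den := by exact_mod_cast r.pos
  have : 0 < autocorr 1 / (2 * r.den) := div_pos autocorr_one_pos (by positivity)
  linarith

/-! ### The two series at rational points -/

theorem ChowlaHasSum.of_one_div {x s : ℝ} (hx : x ∈ Set.Ioo (0 : ℝ) 1)
    (h : ChowlaHasSum (1 / x) s) : ChowlaHasSum x (F x + 1 / 2 * Real.log x - x * s) := by
  have hM : Tendsto (fun N : ℕ => ⌊x * N⌋₊) atTop atTop :=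
    tendsto_nat_floor_atTop.comp (tendsto_natCast_atTop_atTop.const_mul_atTop hx.1)
  have h4 : Tendsto (fun N : ℕ => (4 : ℝ) / (⌊x * N⌋₊ : ℕ)) atTop (𝓝 0) :=
    (tendsto_const_div_atTop_nhds_zero_nat 4).comp hM
  have h5 : Tendsto (fun N : ℕ => chowlaSum N x + x * chowlaSum ⌊x * N⌋₊ (1 / x)
      - (F x + 1 / 2 * Real.log x)) atTop (𝓝 0) := by
    refine squeeze_zero_norm' ?_ h4
    filter_upwards [hM.eventually_gt_atTop 0] with N hN
    exact approx_functional_equation hx.1 hx.2.le hN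
  have h6 : Tendsto (fun N : ℕ => chowlaSum ⌊x * N⌋₊ (1 / x)) atTop (𝓝 s) := h.comp hM
  have := (h5.add_const (F x + 1 / 2 * Real.log x)).sub (h6.const_mul x)
  rw [zero_add] at this
  exact this.congr fun N => by simp only [chowlaSum]; ring

theorem WiltonHasSum.of_one_div {x w : ℝ} (hx : x ∈ Set.Ioo (0 : ℝ) 1)
    (h : WiltonHasSum (1 / x) w) : WiltonHasSum x (Real.log (1 / x) - x * w) := by
  unfold WiltonHasSum at *
  rw [Int.fract_eq_self.2 ⟨hx.1.le, hx.2⟩, ← tendsto_add_atTop_iff_nat 1]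
  have := (h.const_mul (-x)).add_const (Real.log (1 / x))
  have e : -x * w + Real.log (1 / x) = Real.log (1 / x) - x * w := by ring
  rw [e] at this
  refine this.congr fun N => ?_
  rw [Finset.sum_range_succ', gaussTerm_zero_right _ hx.1.ne']
  simp only [gaussTerm_succ]
  rw [← Finset.mul_sum]
  rfl

theorem chowlaHasSum_fract (x s : ℝ) : ChowlaHasSum (Int.fract x) s ↔ ChowlaHasSum x s :=
  tendsto_congr fun N => chowlaSum_fract N x

theorem wiltonHasSum_fract (x w : ℝ) : WiltonHasSum (Int.fract x) w ↔ WiltonHasSum x w := by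
  unfold WiltonHasSum
  rw [Int.fract_fract]

/-- Convergence and the identity pass from 1/r to r together: the term (1/2) log r in the equation
for φ₁ is cancelled by half of log(1/r) in that for 𝒲, leaving the functional equation of G. -/
theorem exists_hasSum_ratCast (r : ℚ) :
    ∃ s w, ChowlaHasSum r s ∧ WiltonHasSum r w ∧ s = -(1 / 2) * w + G r := by
  induction r using rat_gauss_induction with
  | hint r n h =>
    obtain ⟨s, w, hs, hw, e⟩ := h
    have hf : Int.fract (((r + n : ℚ) : ℝ)) = Int.fract (r : ℝ) := by
      push_cast; exact Int.fract_add_intCast _ _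
    refine ⟨s, w, ?_, ?_, ?_⟩
    · rwa [← chowlaHasSum_fract, hf, chowlaHasSum_fract]
    · rwa [← wiltonHasSum_fract, hf, wiltonHasSum_fract]
    · rwa [← G_fract, hf, G_fract]
  | h0 =>
    refine ⟨0, 0, ?_, ?_, ?_⟩
    · simp [ChowlaHasSum, B1]
    · simp [WiltonHasSum, gaussTerm_zero_left]
    · simp [G_zero]
  | hstep r h0 h1 h =>
    obtain ⟨s, w, hs, hw, e⟩ := h
    have hx : (r : ℝ) ∈ Set.Ioo (0 : ℝ) 1 := ⟨by exact_mod_cast h0, by exact_mod_cast h1⟩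
    rw [Rat.cast_inv, ← one_div] at hs hw e
    refine ⟨_, _, hs.of_one_div hx, hw.of_one_div hx, ?_⟩
    rw [G_functional_equation hx, e, one_div (r : ℝ), Real.log_inv]
    ring

/-! ### The two series at irrational points -/

/-- The lengths of the partial sums met when the approximate functional equation is iterated:
`N_0 = N` and `N_{k+1} = ⌊α_k N_k⌋`. -/
def floorIter (x : ℝ) (N : ℕ) : ℕ → ℕ
  | 0 => N
  | k + 1 => ⌊gaussIter k x * floorIter x N k⌋₊

theorem floor_mul_le {a : ℝ} (ha : a ∈ Set.Ico (0 : ℝ) 1) (n : ℕ) : ⌊a * n⌋₊ ≤ n := by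
  refine Nat.floor_le_of_le ?_
  exact mul_le_of_le_one_left (Nat.cast_nonneg n) ha.2.le

theorem floor_mul_lt {a : ℝ} (ha : a ∈ Set.Ico (0 : ℝ) 1) {n : ℕ} (hn : 0 < n) : ⌊a * n⌋₊ < n := by
  have hn' : (0 : ℝ) < n := by exact_mod_cast hn
  rw [Nat.floor_lt (mul_nonneg ha.1 hn'.le)]
  exact mul_lt_of_lt_one_left hn' ha.2

theorem floorIter_antitone {x : ℝ} (hx : x ∈ Set.Ico (0 : ℝ) 1) (N : ℕ) :
    Antitone (floorIter x N) :=
  antitone_nat_of_succ_le fun k => floor_mul_le (gaussIter_mem hx k) _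

/-- The lengths drop strictly while positive. Hence every chain reaches 0, and N_K > 0 forces N ≥ K.
-/
theorem add_floorIter_le {x : ℝ} (hx : x ∈ Set.Ico (0 : ℝ) 1) {N K : ℕ}
    (h : 0 < floorIter x N K) : K + floorIter x N K ≤ N := by
  induction K with
  | zero => simp [floorIter]
  | succ K ih =>
    have h1 : 0 < floorIter x N K := h.trans_le (floorIter_antitone hx N K.le_succ)
    have h2 : floorIter x N (K + 1) < floorIter x N K := floor_mul_lt (gaussIter_mem hx K) h1
    have := ih h1
    omega

theorem floorIter_succ_le {x : ℝ} (hx : x ∈ Set.Ico (0 : ℝ) 1) (N K : ℕ) :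
    floorIter x (N + 1) K ≤ floorIter x N K + 1 := by
  induction K with
  | zero => exact le_rfl
  | succ K ih =>
    have ha := gaussIter_mem hx K
    simp only [floorIter]
    rw [← Nat.lt_succ_iff, Nat.floor_lt (mul_nonneg ha.1 (Nat.cast_nonneg _))]
    have h1 : ((floorIter x (N + 1) K : ℕ) : ℝ) ≤ floorIter x N K + 1 := by exact_mod_cast ih
    have h2 := Nat.lt_floor_add_one (gaussIter K x * floorIter x N K)
    have h3 := mul_le_mul_of_nonneg_left h1 ha.1
    push_cast
    linarith [ha.2]

variable {x : ℝ}

theorem gaussIter_pos (hi : Irrational x) (hx : x ∈ Set.Ico (0 : ℝ) 1) (k : ℕ) :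
    0 < gaussIter k x :=
  lt_of_le_of_ne (gaussIter_mem hx k).1 (irrational_gaussIter hi k).ne_zero.symm

theorem tendsto_floorIter (hi : Irrational x) (hx : x ∈ Set.Ico (0 : ℝ) 1) (k : ℕ) :
    Tendsto (fun N => floorIter x N k) atTop atTop := by
  induction k with
  | zero => exact tendsto_id
  | succ k ih =>
    exact tendsto_nat_floor_atTop.comp
      ((tendsto_natCast_atTop_atTop.comp ih).const_mul_atTop (gaussIter_pos hi hx k))

/-- The terms of the formal expansion of `φ₁` along the continued fraction. -/
def chowlaTerm (x : ℝ) (k : ℕ) : ℝ :=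
  gaussTerm F x k - 1 / 2 * gaussTerm (fun y => Real.log (1 / y)) x k

/-- The approximate functional equation applied K times; its k-th use is at α_k with length N_k and
is weighted by β_{k-1}. -/
theorem abs_chowlaSum_sub_le (hi : Irrational x) (hx : x ∈ Set.Ico (0 : ℝ) 1) {N K : ℕ}
    (h : 0 < floorIter x N K) :
    |chowlaSum N x - ∑ k ∈ Finset.range K, chowlaTerm x k
        - (-1) ^ K * betaPrev K x * chowlaSum (floorIter x N K) (gaussIter K x)|
      ≤ ∑ k ∈ Finset.range K, betaPrev k x * (4 / floorIter x N (k + 1)) := by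
  induction K with
  | zero => simp [floorIter, gaussIter_zero, betaPrev]
  | succ K ih =>
    have ih := ih (h.trans_le (floorIter_antitone hx N K.le_succ))
    have hpos := gaussIter_pos hi hx K
    have hafe := approx_functional_equation hpos (gaussIter_mem hx K).2.le (N := floorIter x N K) h
    have hb := betaPrev_nonneg hx K
    rw [← chowlaSum_fract _ (1 / gaussIter K x)] at hafe
    rw [Finset.sum_range_succ, Finset.sum_range_succ]
    have hg : gaussIter (K + 1) x = Int.fract (1 / gaussIter K x) := gaussIter_succ K x
    have hf : floorIter x N (K + 1) = ⌊gaussIter K x * floorIter x N K⌋₊ := rfl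
    rw [hg, hf, betaPrev_succ, pow_succ, chowlaTerm, gaussTerm, gaussTerm, if_neg hpos.ne',
      if_neg hpos.ne', one_div (gaussIter K x), Real.log_inv, ← one_div (gaussIter K x)]
    set c := chowlaSum ⌊gaussIter K x * floorIter x N K⌋₊ (Int.fract (1 / gaussIter K x))
    set E := chowlaSum (floorIter x N K) (gaussIter K x) + gaussIter K x * c
      - (F (gaussIter K x) + 1 / 2 * Real.log (gaussIter K x)) with hE
    have h2 : |(-1) ^ K * betaPrev K x * E|
        ≤ betaPrev K x * (4 / (⌊gaussIter K x * floorIter x N K⌋₊ : ℕ)) := by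
      rw [abs_mul, abs_mul, abs_pow, abs_neg, abs_one, one_pow, one_mul, abs_of_nonneg hb]
      exact mul_le_mul_of_nonneg_left hafe hb
    refine le_trans (le_of_eq ?_) ((abs_add_le _ _).trans (add_le_add ih h2))
    congr 1
    rw [hE]
    ring

theorem summable_error (hx : x ∈ Set.Ico (0 : ℝ) 1) (N : ℕ) :
    Summable fun k => betaPrev k x * (4 / (floorIter x N (k + 1) : ℝ)) := by
  refine Summable.of_nonneg_of_le
    (fun k => mul_nonneg (betaPrev_nonneg hx k) (by positivity)) (fun k => ?_)
    ((summable_betaPrev hx).mul_right 4)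
  refine mul_le_mul_of_nonneg_left ?_ (betaPrev_nonneg hx k)
  -- Once the chain has reached 0 the convention 4 / 0 = 0 makes the terms vanish; before that they
  -- are at most 4β_{k-1}.
  rcases Nat.eq_zero_or_pos (floorIter x N (k + 1)) with h | h
  · simp [h]
  · exact div_le_self (by norm_num) (by exact_mod_cast h)

/-- For fixed k the length N_{k+1} tends to infinity with N, and 4β_{k-1} is a summable majorant. -/
theorem tendsto_error (hi : Irrational x) (hx : x ∈ Set.Ico (0 : ℝ) 1) :
    Tendsto (fun N : ℕ => ∑' k, betaPrev k x * (4 / (floorIter x N (k + 1) : ℝ)))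
      atTop (𝓝 0) := by
  have : Tendsto (fun N : ℕ => ∑' k, betaPrev k x * (4 / (floorIter x N (k + 1) : ℝ)))
      atTop (𝓝 (∑' _ : ℕ, (0 : ℝ))) := by
    refine tendsto_tsum_of_dominated_convergence ((summable_betaPrev hx).mul_right 4)
      (fun k => ?_) (Eventually.of_forall fun N k => ?_)
    · have := ((tendsto_const_div_atTop_nhds_zero_nat (4 : ℝ)).comp
        (tendsto_floorIter hi hx (k + 1))).const_mul (betaPrev k x)
      rwa [mul_zero] at this
    · rw [norm_mul, Real.norm_of_nonneg (betaPrev_nonneg hx k)]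
      refine mul_le_mul_of_nonneg_left ?_ (betaPrev_nonneg hx k)
      rw [Real.norm_of_nonneg (by positivity)]
      rcases Nat.eq_zero_or_pos (floorIter x N (k + 1)) with h | h
      · simp [h]
      · exact div_le_self (by norm_num) (by exact_mod_cast h)
  rwa [tsum_zero] at this

theorem abs_chowlaSum_sub_le_tsum (hi : Irrational x) (hx : x ∈ Set.Ico (0 : ℝ) 1) {N K : ℕ}
    (h : 0 < floorIter x N K) :
    |chowlaSum N x - ∑ k ∈ Finset.range K, chowlaTerm x k
        - (-1) ^ K * betaPrev K x * chowlaSum (floorIter x N K) (gaussIter K x)|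
      ≤ ∑' k, betaPrev k x * (4 / (floorIter x N (k + 1) : ℝ)) :=
  (abs_chowlaSum_sub_le hi hx h).trans <|
    (summable_error hx N).sum_le_tsum _
      fun k _ => mul_nonneg (betaPrev_nonneg hx k) (by positivity)

theorem tendsto_sum_gaussTerm_F (hx : x ∈ Set.Ico (0 : ℝ) 1) :
    Tendsto (fun K => ∑ k ∈ Finset.range K, gaussTerm F x k) atTop (𝓝 (G x)) := by
  unfold G
  rw [Int.fract_eq_self.2 hx]
  exact (summable_gaussTerm_F hx).hasSum.tendsto_sum_nat

theorem tendsto_betaPrev (hx : x ∈ Set.Ico (0 : ℝ) 1) :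
    Tendsto (fun k => betaPrev k x) atTop (𝓝 0) :=
  (summable_betaPrev hx).tendsto_atTop_zero

theorem exists_floorIter_last (hx : x ∈ Set.Ico (0 : ℝ) 1) {N : ℕ} (hN : 0 < N) :
    ∃ K, 0 < floorIter x N K ∧ floorIter x N (K + 1) = 0 := by
  have hex : ∃ k, floorIter x N k = 0 := by
    refine ⟨N, ?_⟩
    by_contra h
    have := add_floorIter_le hx (Nat.pos_of_ne_zero h)
    omega
  classical
  have h0 : Nat.find hex ≠ 0 := fun h => by
    have := Nat.find_spec hex
    rw [h] at this
    exact hN.ne' this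
  obtain ⟨K, hK⟩ := Nat.exists_eq_succ_of_ne_zero h0
  refine ⟨K, Nat.pos_of_ne_zero (Nat.find_min hex (by omega)), ?_⟩
  have := Nat.find_spec hex
  rwa [hK] at this

/-- Raising N by 1 raises N_K by at most 1, so the least N with N_K > 0 gives N_K = 1. -/
theorem exists_floorIter_eq_one (hi : Irrational x) (hx : x ∈ Set.Ico (0 : ℝ) 1) (K : ℕ) :
    ∃ N, floorIter x N K = 1 := by
  have hex : ∃ N, 0 < floorIter x N K :=
    ((tendsto_floorIter hi hx K).eventually_gt_atTop 0).exists
  classical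
  have hs := Nat.find_spec hex
  have h0 : Nat.find hex ≠ 0 := fun h => by
    rw [h] at hs
    have := add_floorIter_le hx hs
    omega
  obtain ⟨N, hN⟩ := Nat.exists_eq_succ_of_ne_zero h0
  refine ⟨N + 1, ?_⟩
  have h1 := Nat.find_min hex (m := N) (by omega)
  have h2 := floorIter_succ_le hx N K
  rw [hN] at hs
  simp only [Nat.succ_eq_add_one] at hs
  omega

theorem chowlaHasSum_of_wiltonHasSum (hi : Irrational x) (hx : x ∈ Set.Ico (0 : ℝ) 1) {w : ℝ}
    (hw : WiltonHasSum x w) : ChowlaHasSum x (-(1 / 2) * w + G x) := by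
  have hf : Int.fract x = x := Int.fract_eq_self.2 hx
  unfold WiltonHasSum at hw
  rw [hf] at hw
  have hS : Tendsto (fun K => ∑ k ∈ Finset.range K, chowlaTerm x k) atTop
      (𝓝 (-(1 / 2) * w + G x)) := by
    have := (tendsto_sum_gaussTerm_F hx).sub (hw.const_mul (1 / 2))
    have e : G x - 1 / 2 * w = -(1 / 2) * w + G x := by ring
    rw [e] at this
    refine this.congr fun K => ?_
    simp only [chowlaTerm, Finset.sum_sub_distrib, Finset.mul_sum]
  -- The terms of the convergent series 𝒲 tend to 0; this is what controls the remainder.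
  have hterm : Tendsto (fun K => betaPrev K x * Real.log (1 / gaussIter K x)) atTop (𝓝 0) := by
    have h1 := ((tendsto_add_atTop_iff_nat 1).2 hw).sub hw
    rw [sub_self] at h1
    simp only [Finset.sum_range_succ, add_sub_cancel_left] at h1
    refine (tendsto_zero_iff_norm_tendsto_zero.1 h1).congr fun K => ?_
    have hp := gaussIter_pos hi hx K
    rw [gaussTerm, if_neg hp.ne', norm_mul, norm_mul, norm_pow, norm_neg, norm_one, one_pow,
      one_mul, Real.norm_of_nonneg (betaPrev_nonneg hx K), Real.norm_of_nonneg]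
    exact Real.log_nonneg ((one_le_div hp).2 (gaussIter_mem hx K).2.le)
  have hbound : Tendsto (fun K => betaPrev K x + betaPrev K x * Real.log (1 / gaussIter K x))
      atTop (𝓝 0) := by
    simpa using (tendsto_betaPrev hx).add hterm
  have hex : ∀ N : ℕ, ∃ K, 0 < N → 0 < floorIter x N K ∧ floorIter x N (K + 1) = 0 := fun N => by
    rcases Nat.eq_zero_or_pos N with h | h
    · exact ⟨0, fun h' => absurd h h'.ne'⟩
    · obtain ⟨K, hK⟩ := exists_floorIter_last hx h
      exact ⟨K, fun _ => hK⟩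
  choose K hK using hex
  -- For each fixed b, N_b is positive once N is large, so the chain cannot end before b.
  have hKt : Tendsto K atTop atTop := by
    refine tendsto_atTop.2 fun b => ?_
    filter_upwards [(tendsto_floorIter hi hx b).eventually_gt_atTop 0, eventually_gt_atTop 0]
      with N hN hN0
    by_contra! hlt
    have := floorIter_antitone hx N (show K N + 1 ≤ b from hlt)
    have := (hK N hN0).2
    omega
  have hR : Tendsto (fun N => (-1) ^ K N * betaPrev (K N) x
      * chowlaSum (floorIter x N (K N)) (gaussIter (K N) x)) atTop (𝓝 0) := by
    refine squeeze_zero_norm' ?_ (hbound.comp hKt)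
    filter_upwards [eventually_gt_atTop 0] with N hN
    obtain ⟨h1, h2⟩ := hK N hN
    have hp := gaussIter_pos hi hx (K N)
    have h1' : (0 : ℝ) < floorIter x N (K N) := by exact_mod_cast h1
    -- Since N_{K+1} = 0, α_K N_K < 1; the bound 1 + log N_K then becomes 1 + log(1/α_K).
    have h3 : (floorIter x N (K N) : ℝ) ≤ 1 / gaussIter (K N) x := by
      rw [le_div_iff₀ hp, mul_comm]
      exact (Nat.floor_eq_zero.1 h2).le
    rw [norm_mul, norm_mul, norm_pow, norm_neg, norm_one, one_pow, one_mul,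
      Real.norm_of_nonneg (betaPrev_nonneg hx _), Real.norm_eq_abs]
    simp only [Function.comp_apply]
    calc betaPrev (K N) x * |chowlaSum (floorIter x N (K N)) (gaussIter (K N) x)|
        ≤ betaPrev (K N) x * (1 + Real.log (1 / gaussIter (K N) x)) :=
          mul_le_mul_of_nonneg_left ((abs_chowlaSum_le _ _).trans
            (add_le_add_right (Real.log_le_log h1' h3) _)) (betaPrev_nonneg hx _)
      _ = _ := by ring
  have hE : Tendsto (fun N => chowlaSum N x - ∑ k ∈ Finset.range (K N), chowlaTerm x k
      - (-1) ^ K N * betaPrev (K N) x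
        * chowlaSum (floorIter x N (K N)) (gaussIter (K N) x)) atTop (𝓝 0) := by
    refine squeeze_zero_norm' ?_ (tendsto_error hi hx)
    filter_upwards [eventually_gt_atTop 0] with N hN
    exact abs_chowlaSum_sub_le_tsum hi hx (hK N hN).1
  have := (hE.add hR).add (hS.comp hKt)
  rw [add_zero, zero_add] at this
  exact this.congr fun N => by simp only [chowlaSum, Function.comp_apply]; ring

theorem wiltonHasSum_of_chowlaHasSum (hi : Irrational x) (hx : x ∈ Set.Ico (0 : ℝ) 1) {s : ℝ}
    (hs : ChowlaHasSum x s) : WiltonHasSum x (2 * (G x - s)) := by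
  have hf : Int.fract x = x := Int.fract_eq_self.2 hx
  unfold WiltonHasSum
  rw [hf]
  choose N hN using exists_floorIter_eq_one hi hx
  have hpos : ∀ K, 0 < floorIter x (N K) K := fun K => by rw [hN K]; exact one_pos
  -- As N ≥ K, the partial sums of φ₁ are sampled along lengths tending to infinity.
  have hNt : Tendsto N atTop atTop := by
    refine tendsto_atTop_mono (fun K => ?_) tendsto_id
    exact (Nat.le_add_right _ _).trans (add_floorIter_le hx (hpos K))
  have hR : Tendsto (fun K => (-1) ^ K * betaPrev K x
      * chowlaSum (floorIter x (N K) K) (gaussIter K x)) atTop (𝓝 0) := by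
    refine squeeze_zero_norm (fun K => ?_) (tendsto_betaPrev hx)
    rw [norm_mul, norm_mul, norm_pow, norm_neg, norm_one, one_pow, one_mul,
      Real.norm_of_nonneg (betaPrev_nonneg hx _), hN K]
    refine mul_le_of_le_one_right (betaPrev_nonneg hx _) ?_
    simpa using abs_chowlaSum_le 1 (gaussIter K x)
  have hE : Tendsto (fun K => chowlaSum (N K) x - ∑ k ∈ Finset.range K, chowlaTerm x k
      - (-1) ^ K * betaPrev K x
        * chowlaSum (floorIter x (N K) K) (gaussIter K x)) atTop (𝓝 0) :=
    squeeze_zero_norm (fun K => abs_chowlaSum_sub_le_tsum hi hx (hpos K))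
      ((tendsto_error hi hx).comp hNt)
  have hs' : Tendsto (fun K => chowlaSum (N K) x) atTop (𝓝 s) := hs.comp hNt
  have := ((((tendsto_sum_gaussTerm_F hx).sub hs').add hE).add hR).const_mul 2
  rw [add_zero, add_zero] at this
  refine this.congr fun K => ?_
  simp only [chowlaTerm, Finset.sum_sub_distrib, ← Finset.mul_sum]
  ring

theorem chowlaHasSum_iff (x : ℝ) : (∃ s, ChowlaHasSum x s) ↔ ∃ w, WiltonHasSum x w := by
  by_cases hi : Irrational x
  · have hi' := irrational_fract hi
    constructor
    · rintro ⟨s, hs⟩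
      exact ⟨_, (wiltonHasSum_fract _ _).1 (wiltonHasSum_of_chowlaHasSum hi' (fract_mem x)
        ((chowlaHasSum_fract _ _).2 hs))⟩
    · rintro ⟨w, hw⟩
      exact ⟨_, (chowlaHasSum_fract _ _).1 (chowlaHasSum_of_wiltonHasSum hi' (fract_mem x)
        ((wiltonHasSum_fract _ _).2 hw))⟩
  · obtain ⟨r, rfl⟩ : ∃ r : ℚ, (r : ℝ) = x := by simpa [Irrational] using hi
    obtain ⟨s, w, hs, hw, -⟩ := exists_hasSum_ratCast r
    exact ⟨fun _ => ⟨w, hw⟩, fun _ => ⟨s, hs⟩⟩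

theorem ChowlaHasSum.eq_of_wiltonHasSum {x s w : ℝ} (hs : ChowlaHasSum x s)
    (hw : WiltonHasSum x w) : s = -(1 / 2) * w + G x := by
  by_cases hi : Irrational x
  · rw [← G_fract]
    exact tendsto_nhds_unique ((chowlaHasSum_fract _ _).2 hs) (chowlaHasSum_of_wiltonHasSum
      (irrational_fract hi) (fract_mem x) ((wiltonHasSum_fract _ _).2 hw))
  · obtain ⟨r, rfl⟩ : ∃ r : ℚ, (r : ℝ) = x := by simpa [Irrational] using hi
    obtain ⟨s', w', hs', hw', e⟩ := exists_hasSum_ratCast r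
    rw [tendsto_nhds_unique hs hs', tendsto_nhds_unique hw hw', e]

end
end ChowlaWilton

open ChowlaWilton in
theorem mainTheorem1 :
    -- the two series converge at the same points: the rationals and the Wilton points
    (∀ x : ℝ, (∃ s, ChowlaHasSum x s) ↔ ∃ w, WiltonHasSum x w) ∧
    (∀ x : ℝ, (∃ s, ChowlaHasSum x s) ↔ ((∃ r : ℚ, (r : ℝ) = x) ∨ IsWiltonPoint x)) ∧
    -- the series that defines `G` converges absolutely everywhere
    (∀ x : ℝ, Summable (gaussTerm F (Int.fract x))) ∧
    -- `G` extends `φ₁ + 𝒲 / 2`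
    (∀ x s w : ℝ, ChowlaHasSum x s → WiltonHasSum x w → s = -(1 / 2) * w + G x) ∧
    -- properties of `G`
    Function.Periodic G 1 ∧
    (∃ C : ℝ, ∀ x : ℝ, |G x| ≤ C) ∧
    (∀ x : ℝ, Irrational x → ContinuousAt G x) ∧
    (∀ r : ℚ, IsJumpDiscontinuityAt G r) ∧
    (∀ r : ℚ,
      Tendsto G (𝓝[>] (r : ℝ)) (𝓝 (G r + autocorr 1 / (2 * r.den))) ∧
      Tendsto G (𝓝[<] (r : ℝ)) (𝓝 (G r - autocorr 1 / (2 * r.den)))) := by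
  refine ⟨chowlaHasSum_iff, fun x => ⟨fun h => ?_, ?_⟩, fun x => summable_gaussTerm_F (fract_mem x),
    fun x s w hs hw => hs.eq_of_wiltonHasSum hw, G_periodic, exists_abs_G_le,
    fun x hx => continuousAt_G hx, isJumpDiscontinuityAt_G, hasJump_ratCast⟩
  · by_cases hi : Irrational x
    · exact Or.inr ⟨hi, (chowlaHasSum_iff x).1 h⟩
    · exact Or.inl (by simpa [Irrational] using hi)
  · rintro (⟨r, rfl⟩ | h)
    · obtain ⟨s, w, hs, -⟩ := exists_hasSum_ratCast r
      exact ⟨s, hs⟩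
    · exact (chowlaHasSum_iff x).2 h.2
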